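/- Let $c=\sqrt{\pi}$. On $m$ modes, with Hilbert space $L^2(\mathbb{R}^m)$, let $\hat V(v_1,v_2)=\exp[-i(v_1\cdot\hat p-v_2\cdot\hat q)]$ for $v_1,v_2\in\mathbb{R}^m$, i.e. the tensor product of the single-mode displacements. For one mode let $|\overline{\mu}\rangle=\sum_{k\in\mathbb{Z}}|c(2k+\mu)\rangle_q$ ($\mu=0,1$) be the ideal GKP codewords of the square lattice, and let $|\mu;z_1,z_2\rangle=c^{-1/2}\,\hat V(z_1,z_2)|\overline{\mu}\rangle$ for $z_1,z_2\in[-\tfrac c2,\tfrac c2)$ (generalized states, normalized so that they resolve the identity). They define the stabilizer subsystem (SSS) decomposition $L^2(\mathbb{R})=\mathbb{C}^2\otimes\mathcal{H}_S$, where $\mathcal{H}_S=L^2([-\tfrac c2,\tfrac c2)^2)$, by $|\mu\rangle\otimes g=\int g(z_1,z_2)|\mu;z_1,z_2\rangle\,dz_1dz_2$; for several modes one takes tensor products. * The SSS $r$-filter of a mode is the projection $\hat\Pi_r=\hat I\otimes\mathbf{1}[\,|z_1|<r,\ |z_2|<r\,]$, where $0<r\le c/2$. The ideal decoder is $\mathcal{D}(\hat\rho)=\mathrm{Tr}_S(\hat\rho)$,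 the partial trace over the factors $\mathcal{H}_S$ of all the modes. * An $s$-parameterized noise channel $\mathcal{N}^s$ on $m$ modes is a completely positive trace-preserving map $\mathcal{N}^s(\hat\rho)=\sum_k\hat K_k\hat\rho\hat K_k^\dagger$ (countably many Kraus operators, $\sum_k\hat K_k^\dagger\hat K_k=\hat I$) whose Kraus operators are linear combinations of the displacements $\hat V(v_1,v_2)$ with all components of $v_1$ and $v_2$ in $[-s,s)$. Here "linear combination" includes integrals and, in general, limits of finite linear combinations in the weak operator topology. * The gates, each given as a qubit gate $U$ and a mode operator $\hat U$, are: $X$ and $\hat V(c,0)$; $Z$ and $\hat V(0,c)$; the Hadamard gate $H$ and the Fourier rotation $\hat F=\exp(i\tfrac{\pi}{2}\hat n)$ with $\hat n=(\hat q^2+\hat p^2-1)/2$; the one-qubit identity $I$ and $\hat I$; CNOT (control on the first qubit) and the SUM gate $\exp(-i\hat q_1\hat p_2)$. * The $s$-gate of $U$ is $\hat\rho\mapsto\mathcal{G}(\hat\rho)=\mathcal{N}^s(\hat U\hat\rho\hat U^\dagger)$. Proposition (fault-tolerance condition for the $s$-gate). Let $U$ be one of these gates, acting on $m$ qubits ($m=1$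 or $2$), let $\mathcal{N}^s$ be any $s$-parameterized noise channel on $m$ modes, let $r_1,\dots,r_m>0$ with $\sum_i r_i+s<\sqrt{\pi}/2$, and write $\hat\Pi=\bigotimes_i\hat\Pi_{r_i}$ and $\hat\Pi'=\bigotimes_{i=1}^m\hat\Pi_{R}$ with $R=\sum_j r_j+s$. Then for every trace-class operator $\hat\rho$ on $L^2(\mathbb{R}^m)$, in particular for every density operator: * Gate A: $\mathcal{G}(\hat\Pi\hat\rho\hat\Pi)=\hat\Pi'\,\mathcal{G}(\hat\Pi\hat\rho\hat\Pi)\,\hat\Pi'$. * Gate B: $\mathcal{D}\bigl(\mathcal{G}(\hat\Pi\hat\rho\hat\Pi)\bigr)=U\,\mathcal{D}(\hat\Pi\hat\rho\hat\Pi)\,U^\dagger$. -/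

import Mathlib

noncomputable section

open MeasureTheory
open scoped ENNReal InnerProductSpace ComplexConjugate FourierTransform ContDiff

namespace GKP

/-- The lattice constant `c = √π`. -/
def c : ℝ := Real.sqrt Real.pi

lemma c_pos : 0 < c := Real.sqrt_pos.mpr Real.pi_pos
lemma c_sq : c * c = Real.pi := Real.mul_self_sqrt Real.pi_pos.le

/-- The Hilbert space `L²(ℝ^m)` of `m` oscillator modes in the position representation. -/
abbrev Mode (m : ℕ) : Type := Lp ℂ 2 (volume : Measure (Fin m → ℝ))

/-- The half-open cube `[-c/2, c/2)^m`. -/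
def cell (m : ℕ) : Set (Fin m → ℝ) := Set.univ.pi fun _ => Set.Ico (-(c / 2)) (c / 2)

/-- Lebesgue measure on the cube `[-c/2, c/2)^m`. -/
abbrev cellMeasure (m : ℕ) : Measure (Fin m → ℝ) := volume.restrict (cell m)

/-- The syndrome space of `m` modes: square-integrable functions of `(z₁, z₂)` with
`z₁, z₂ ∈ [-c/2, c/2)^m`. -/
abbrev Syndrome (m : ℕ) : Type := Lp ℂ 2 ((cellMeasure m).prod (cellMeasure m))

/-- Labels of the computational basis of `m` logical qubits. -/
abbrev Bits (m : ℕ) : Type := Fin m → Fin 2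

/-- The integers `n` for which `c * n` is `x` rounded to `c ℤ^m`. -/
def latticeIndex {m : ℕ} (x : Fin m → ℝ) : Fin m → ℤ := fun i => ⌊x i / c + 1 / 2⌋

/-- The remainder `x - c * n` of rounding `x` to `c ℤ^m`; it lies in the cell. -/
def residual {m : ℕ} (x : Fin m → ℝ) : Fin m → ℝ := fun i => x i - c * latticeIndex x i

/-- Multiplication by an essentially bounded function, as an operator on `L²`. -/
def mulOp {α : Type*} [MeasurableSpace α] (μ : Measure α) (f : α → ℂ) (hf : MemLp f ∞ μ) :
    Lp ℂ 2 μ →L[ℂ] Lp ℂ 2 μ :=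
  (ContinuousLinearMap.mul ℂ ℂ).holderL μ ∞ 2 2 (hf.toLp f)

lemma latticeIndex_eq_iff {m : ℕ} (x : Fin m → ℝ) (n : Fin m → ℤ) :
    latticeIndex x = n ↔ (x - fun i => c * (n i : ℝ)) ∈ cell m := by
  have hc := c_pos
  simp only [latticeIndex, cell, Set.mem_univ_pi, funext_iff, Int.floor_eq_iff, Pi.sub_apply,
    Set.mem_Ico]
  refine forall_congr' fun i => ?_
  have h : x i = c * (x i / c) := by field_simp
  constructor
  · rintro ⟨h1, h2⟩; constructor <;> nlinarith
  · rintro ⟨h1, h2⟩; constructor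
    · by_contra hh; push Not at hh; nlinarith
    · by_contra hh; push Not at hh; nlinarith

lemma measurableSet_cell (m : ℕ) : MeasurableSet (cell m) :=
  MeasurableSet.univ_pi fun _ => measurableSet_Ico

lemma lintegral_wrap {m : ℕ} (F : (Fin m → ℤ) → (Fin m → ℝ) → ℝ≥0∞) :
    ∫⁻ x, F (latticeIndex x) (residual x) = ∑' n, ∫⁻ z, F n z ∂(cellMeasure m) := by
  have hS : ∀ n : Fin m → ℤ, {x : Fin m → ℝ | latticeIndex x = n} =
      (fun x => x - fun i => c * (n i : ℝ)) ⁻¹' cell m := fun n => by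
    ext x; exact latticeIndex_eq_iff x n
  have hm : ∀ n : Fin m → ℤ, MeasurableSet {x : Fin m → ℝ | latticeIndex x = n} := fun n => by
    rw [hS]; exact (measurable_id.sub_const _) (measurableSet_cell m)
  have hU : (⋃ n : Fin m → ℤ, {x : Fin m → ℝ | latticeIndex x = n}) = Set.univ := by
    ext x; simp
  rw [← setLIntegral_univ, ← hU, lintegral_iUnion hm]
  · refine tsum_congr fun n => ?_
    have h1 : ∫⁻ x in {x : Fin m → ℝ | latticeIndex x = n}, F (latticeIndex x) (residual x) =
        ∫⁻ x in {x : Fin m → ℝ | latticeIndex x = n}, F n (x - fun i => c * (n i : ℝ)) := by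
      refine setLIntegral_congr_fun (hm n) fun x hx => ?_
      have hx' : latticeIndex x = n := hx
      simp only [hx']
      congr 1
      ext i; simp [residual, hx']
    rw [h1, ← lintegral_indicator (hm n), cellMeasure, ← lintegral_indicator (measurableSet_cell m),
      ← lintegral_sub_right_eq_self ((cell m).indicator (F n)) (fun i => c * (n i : ℝ))]
    refine lintegral_congr fun x => ?_
    rw [hS]; rfl
  · intro n n' hn
    rw [Function.onFun, Set.disjoint_left]
    intro x hx hx'
    exact hn (hx.symm.trans hx')

lemma measurable_latticeIndex (m : ℕ) : Measurable (latticeIndex (m := m)) := by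
  unfold latticeIndex; fun_prop

lemma measurable_residual (m : ℕ) : Measurable (residual (m := m)) := by
  unfold residual
  refine measurable_pi_lambda _ fun i => ?_
  have := (measurable_pi_apply i).comp (measurable_latticeIndex m)
  have h2 : Measurable fun x : Fin m → ℝ => ((latticeIndex x i : ℤ) : ℝ) :=
    (measurable_from_top (f := fun k : ℤ => (k : ℝ))).comp this
  exact (measurable_pi_apply i).sub (h2.const_mul c)

lemma quasi_residual (m : ℕ) :
    Measure.QuasiMeasurePreserving (residual (m := m)) volume (cellMeasure m) := by
  refine ⟨measurable_residual m, ?_⟩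
  refine Measure.AbsolutelyContinuous.mk fun s hs h0 => ?_
  rw [Measure.map_apply (measurable_residual m) hs, ← lintegral_indicator_one
    (measurable_residual m hs)]
  have := lintegral_wrap (m := m) fun _ z => s.indicator 1 z
  rw [show (fun x => (residual ⁻¹' s).indicator (1 : (Fin m → ℝ) → ℝ≥0∞) x) =
    fun x => s.indicator 1 (residual x) from rfl, this]
  simp [lintegral_indicator_one hs, h0]

/-- The integers `n` have the parities `μ`. -/
def matchesBits {m : ℕ} (n : Fin m → ℤ) (μ : Bits m) : Prop := ∀ i, n i % 2 = ((μ i : ℕ) : ℤ)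

lemma integral_exp_cell (k : ℤ) (hk : k % 2 = 0) :
    ∫ z in Set.Ico (-(c / 2)) (c / 2), Complex.exp (Complex.I * ((c * k * z : ℝ) : ℂ)) =
      if k = 0 then (c : ℂ) else 0 := by
  have hc := c_pos
  rw [integral_Ico_eq_integral_Ioo, ← integral_Ioc_eq_integral_Ioo,
    ← intervalIntegral.integral_of_le (by linarith)]
  split_ifs with h
  · subst h; simp
  · have hne : Complex.I * ((c * k : ℝ) : ℂ) ≠ 0 := by
      simp [h, hc.ne']
    have h1 : ∀ z : ℝ, Complex.exp (Complex.I * ((c * k * z : ℝ) : ℂ)) =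
        Complex.exp ((Complex.I * ((c * k : ℝ) : ℂ)) * (z : ℂ)) := fun z => by
      congr 1; push_cast; ring
    simp_rw [h1]
    rw [integral_exp_mul_complex hne]
    obtain ⟨j, rfl⟩ : (2 : ℤ) ∣ k := Int.dvd_of_emod_eq_zero hk
    have h2 : Complex.I * ((c * (2 * j : ℤ) : ℝ) : ℂ) * ((c / 2 : ℝ) : ℂ) =
        Complex.I * ((c * (2 * j : ℤ) : ℝ) : ℂ) * ((-(c / 2) : ℝ) : ℂ) +
          j * (2 * Real.pi * Complex.I) := by
      rw [← c_sq]; push_cast; ring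
    rw [h2, Complex.exp_add, Complex.exp_int_mul_two_pi_mul_I]
    simp

lemma cellMeasure_eq (m : ℕ) : cellMeasure m =
    Measure.pi fun _ : Fin m => (volume : Measure ℝ).restrict (Set.Ico (-(c / 2)) (c / 2)) := by
  rw [cellMeasure, cell, volume_pi, Measure.restrict_pi_pi]

instance (m : ℕ) : IsFiniteMeasure (cellMeasure m) := by
  rw [cellMeasure_eq]; infer_instance

/-- The exponentials `c^(-m/2) exp(-i c n · z)`, orthonormal on the cell when the `n` have a fixed
parity. -/
def cellChar {m : ℕ} (n : Fin m → ℤ) (z : Fin m → ℝ) : ℂ :=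
  ((Real.sqrt c) ^ m : ℝ)⁻¹ * Complex.exp (-(Complex.I * ((∑ i, c * n i * z i : ℝ) : ℂ)))

lemma measurable_cellChar {m : ℕ} (n : Fin m → ℤ) : Measurable (cellChar n) := by
  unfold cellChar; fun_prop

lemma norm_cellChar {m : ℕ} (n : Fin m → ℤ) (z : Fin m → ℝ) :
    ‖cellChar n z‖ = ((Real.sqrt c) ^ m)⁻¹ := by
  have hc := c_pos
  rw [cellChar, norm_mul, ← mul_neg, ← Complex.ofReal_neg, mul_comm Complex.I,
    Complex.norm_exp_ofReal_mul_I]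
  rw [mul_one, Complex.norm_real, Real.norm_of_nonneg (by positivity)]

lemma memLp_cellChar {m : ℕ} (n : Fin m → ℤ) : MemLp (cellChar n) 2 (cellMeasure m) :=
  MemLp.of_bound (measurable_cellChar n).aestronglyMeasurable _
    (Filter.Eventually.of_forall fun z => (norm_cellChar n z).le)

lemma inner_cellChar {m : ℕ} (n n' : Fin m → ℤ) (μ : Bits m) (hn : matchesBits n μ)
    (hn' : matchesBits n' μ) :
    ⟪(memLp_cellChar n).toLp _, (memLp_cellChar n').toLp _⟫_ℂ = if n = n' then 1 else 0 := by
  have hc := c_pos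
  rw [L2.inner_def]
  have h1 : ∫ z, ⟪(memLp_cellChar n).toLp _ z, (memLp_cellChar n').toLp _ z⟫_ℂ ∂(cellMeasure m) =
      ∫ z, (c ^ m : ℝ)⁻¹ * ∏ i, Complex.exp (Complex.I * ((c * (n i - n' i : ℤ) * z i : ℝ) : ℂ))
        ∂(cellMeasure m) := by
    refine integral_congr_ae ?_
    filter_upwards [(memLp_cellChar n).coeFn_toLp, (memLp_cellChar n').coeFn_toLp] with z h1 h2
    rw [h1, h2, ← Complex.exp_sum, ← Finset.mul_sum, ← Complex.ofReal_sum]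
    simp only [RCLike.inner_apply, cellChar, map_mul, ← Complex.exp_conj, map_neg, Complex.conj_I,
      Complex.conj_ofReal]
    rw [mul_mul_mul_comm, ← Complex.exp_add, ← Complex.ofReal_mul]
    congr 2
    · rw [← mul_inv, ← mul_pow, Real.mul_self_sqrt hc.le]
    · push_cast
      simp only [neg_mul, neg_neg, Finset.mul_sum, ← Finset.sum_neg_distrib,
        ← Finset.sum_add_distrib]
      exact Finset.sum_congr rfl fun i _ => by ring
  rw [h1, integral_const_mul, cellMeasure_eq,
    integral_fintype_prod_eq_prod (𝕜 := ℂ)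
      (fun i (z : ℝ) => Complex.exp (Complex.I * ((c * (n i - n' i : ℤ) * z : ℝ) : ℂ)))]
  have h2 : ∀ i, ∫ z in Set.Ico (-(c / 2)) (c / 2),
      Complex.exp (Complex.I * ((c * (n i - n' i : ℤ) * z : ℝ) : ℂ)) =
        if n i - n' i = 0 then (c : ℂ) else 0 := fun i =>
    integral_exp_cell _ (by have := hn i; have := hn' i; omega)
  simp_rw [h2]
  split_ifs with h
  · subst h
    have : (c : ℂ) ≠ 0 := by exact_mod_cast hc.ne'
    simp [this]
  · obtain ⟨i, hi⟩ := Function.ne_iff.mp h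
    rw [Finset.prod_eq_zero (Finset.mem_univ i), mul_zero]
    rw [if_neg (by omega)]

lemma bessel_cell {m : ℕ} (μ : Bits m) (φ : (Fin m → ℝ) → ℂ)
    (hφ : AEStronglyMeasurable φ (cellMeasure m)) :
    ∑' n : {n : Fin m → ℤ // matchesBits n μ},
      ‖∫ z, conj (cellChar n.1 z) * φ z ∂(cellMeasure m)‖ₑ ^ 2 ≤
        ∫⁻ z, ‖φ z‖ₑ ^ 2 ∂(cellMeasure m) := by
  by_cases hL : MemLp φ 2 (cellMeasure m)
  swap
  · have : ∫⁻ z, ‖φ z‖ₑ ^ 2 ∂(cellMeasure m) = ⊤ := by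
      by_contra h
      refine hL ⟨hφ, ?_⟩
      rw [eLpNorm_lt_top_iff_lintegral_rpow_enorm_lt_top (by simp) (by simp)]
      simpa using lt_top_iff_ne_top.mpr h
    rw [this]; exact le_top
  let e : {n : Fin m → ℤ // matchesBits n μ} → Lp ℂ 2 (cellMeasure m) :=
    fun n => (memLp_cellChar n.1).toLp _
  have he : Orthonormal ℂ e := by
    rw [orthonormal_iff_ite]
    intro n n'
    rw [inner_cellChar n.1 n'.1 μ n.2 n'.2]
    simp [Subtype.ext_iff]
  have hin : ∀ n, ⟪e n, hL.toLp φ⟫_ℂ = ∫ z, conj (cellChar n.1 z) * φ z ∂(cellMeasure m) := by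
    intro n
    rw [L2.inner_def]
    refine integral_congr_ae ?_
    filter_upwards [(memLp_cellChar n.1).coeFn_toLp, hL.coeFn_toLp] with z h1 h2
    rw [h1, h2, RCLike.inner_apply, mul_comm]
  have hb := he.tsum_inner_products_le (hL.toLp φ)
  have hs := he.inner_products_summable (hL.toLp φ)
  have h1 : ∀ n, ‖∫ z, conj (cellChar n.1 z) * φ z ∂(cellMeasure m)‖ₑ ^ 2 =
      ENNReal.ofReal (‖⟪e n, hL.toLp φ⟫_ℂ‖ ^ 2) := fun n => by
    rw [hin, ENNReal.ofReal_pow (norm_nonneg _), ofReal_norm]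
  simp_rw [h1]
  rw [← ENNReal.ofReal_tsum_of_nonneg (fun _ => by positivity) hs]
  refine (ENNReal.ofReal_le_ofReal hb).trans (le_of_eq ?_)
  rw [ENNReal.ofReal_pow (norm_nonneg _), Lp.norm_toLp, ENNReal.ofReal_toReal hL.2.ne,
    eLpNorm_eq_lintegral_rpow_enorm_toReal (by simp) (by simp), ← ENNReal.rpow_natCast,
    ← ENNReal.rpow_mul]
  simp

/-- The amplitude of the generalized state `|μ; z₁, z₂⟩ = V(z₁, z₂)|μ̄⟩` at the position `z₁ + c n`
(for `n` of parity `μ`, the amplitude being zero for the other `n`), where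
`|μ̄⟩ = ∑ |c n⟩` over the integers `n` of parity `μ`, normalized so that these states resolve the
identity: `c^(-m/2) exp(i z₂ · (z₁ / 2 + c n))`. -/
def sssKet {m : ℕ} (n : Fin m → ℤ) (z₁ z₂ : Fin m → ℝ) : ℂ :=
  ((Real.sqrt c) ^ m : ℝ)⁻¹ * Complex.exp (Complex.I * ((∑ i, z₂ i * (z₁ i / 2 + c * n i) : ℝ) : ℂ))

open Classical in
/-- The wave function `∫ g(z₁, z₂) |μ; z₁, z₂⟩ dz₁ dz₂` for a function `g` on the cell. At the position
`x = z₁ + c n` only the given `z₁` contributes, which leaves the integral over `z₂`. -/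
def sssFun {m : ℕ} (μ : Bits m) (g : (Fin m → ℝ) × (Fin m → ℝ) → ℂ) (x : Fin m → ℝ) : ℂ :=
  if matchesBits (latticeIndex x) μ then
    ∫ z₂, sssKet (latticeIndex x) (residual x) z₂ * g (residual x, z₂) ∂(cellMeasure m)
  else 0

lemma sssKet_eq {m : ℕ} (n : Fin m → ℤ) (z₁ z₂ : Fin m → ℝ) : sssKet n z₁ z₂ =
    conj (cellChar n z₂) * Complex.exp (((∑ i, z₂ i * z₁ i / 2 : ℝ) : ℂ) * Complex.I) := by
  simp only [sssKet, cellChar, map_mul, ← Complex.exp_conj, map_neg, Complex.conj_I,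
      Complex.conj_ofReal]
  rw [mul_assoc, ← Complex.exp_add, mul_comm _ Complex.I, neg_mul, neg_neg, ← mul_add,
    ← Complex.ofReal_add, ← Finset.sum_add_distrib]
  congr 5
  funext i; ring

lemma norm_sssKet {m : ℕ} (n : Fin m → ℤ) (z₁ z₂ : Fin m → ℝ) :
    ‖sssKet n z₁ z₂‖ = ((Real.sqrt c) ^ m)⁻¹ := by
  rw [sssKet_eq, norm_mul, Complex.norm_exp_ofReal_mul_I, mul_one, RCLike.norm_conj, norm_cellChar]

lemma stronglyMeasurable_sssFun {m : ℕ} (μ : Bits m) (g : (Fin m → ℝ) × (Fin m → ℝ) → ℂ)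
    (hg : StronglyMeasurable g) : StronglyMeasurable (sssFun μ g) := by
  have hk : Measurable fun p : (Fin m → ℝ) × (Fin m → ℝ) =>
      sssKet (latticeIndex p.1) (residual p.1) p.2 := by
    unfold sssKet
    have h1 : ∀ i, Measurable fun p : (Fin m → ℝ) × (Fin m → ℝ) =>
        ((latticeIndex p.1 i : ℤ) : ℝ) := fun i =>
      (measurable_from_top (f := fun k : ℤ => (k : ℝ))).comp
        ((measurable_pi_apply i).comp ((measurable_latticeIndex m).comp measurable_fst))
    have h2 : ∀ i, Measurable fun p : (Fin m → ℝ) × (Fin m → ℝ) => residual p.1 i := fun i =>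
      (measurable_pi_apply i).comp ((measurable_residual m).comp measurable_fst)
    fun_prop
  have hg' : StronglyMeasurable fun p : (Fin m → ℝ) × (Fin m → ℝ) => g (residual p.1, p.2) :=
    hg.comp_measurable (((measurable_residual m).comp measurable_fst).prodMk measurable_snd)
  unfold sssFun
  refine StronglyMeasurable.ite ?_ (hk.stronglyMeasurable.mul hg').integral_prod_right'
    stronglyMeasurable_const
  exact measurable_latticeIndex m (MeasurableSet.of_discrete (s := {n | matchesBits n μ}))

lemma eLpNorm_sssFun_le {m : ℕ} (μ : Bits m) (g : (Fin m → ℝ) × (Fin m → ℝ) → ℂ)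
    (hg : StronglyMeasurable g) :
    eLpNorm (sssFun μ g) 2 volume ≤ eLpNorm g 2 ((cellMeasure m).prod (cellMeasure m)) := by
  classical
  rw [eLpNorm_eq_lintegral_rpow_enorm_toReal (by simp) (by simp),
    eLpNorm_eq_lintegral_rpow_enorm_toReal (by simp) (by simp)]
  refine ENNReal.rpow_le_rpow ?_ (by simp)
  simp only [ENNReal.toReal_ofNat, ENNReal.rpow_ofNat]
  let F : (Fin m → ℤ) → (Fin m → ℝ) → ℝ≥0∞ := fun n z₁ =>
    if matchesBits n μ then ‖∫ z₂, sssKet n z₁ z₂ * g (z₁, z₂) ∂(cellMeasure m)‖ₑ ^ 2 else 0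
  have h1 : ∀ x, ‖sssFun μ g x‖ₑ ^ 2 = F (latticeIndex x) (residual x) := fun x => by
    simp only [sssFun, F]; split_ifs <;> simp
  simp_rw [h1]
  rw [lintegral_wrap, lintegral_prod _ (hg.enorm.pow_const 2).aemeasurable,
    ← lintegral_tsum]
  · refine lintegral_mono fun z₁ => ?_
    let φ : (Fin m → ℝ) → ℂ := fun z₂ =>
      Complex.exp (((∑ i, z₂ i * z₁ i / 2 : ℝ) : ℂ) * Complex.I) * g (z₁, z₂)
    have hφ : StronglyMeasurable φ := by
      refine StronglyMeasurable.mul ?_ (hg.comp_measurable measurable_prodMk_left)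
      exact Continuous.stronglyMeasurable (by fun_prop)
    have h2 := bessel_cell μ φ hφ.aestronglyMeasurable
    have h3 : ∀ z₂, ‖φ z₂‖ₑ = ‖g (z₁, z₂)‖ₑ := fun z₂ => by
      rw [← ofReal_norm, ← ofReal_norm, norm_mul, Complex.norm_exp_ofReal_mul_I, one_mul]
    simp_rw [h3] at h2
    refine le_trans (le_of_eq ?_) h2
    rw [← tsum_subtype_eq_of_support_subset (s := {n | matchesBits n μ})]
    · refine tsum_congr fun n => ?_
      have : matchesBits n.1 μ := n.2
      simp only [F, this, if_true, φ, sssKet_eq, mul_assoc]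
    · intro n hn
      by_contra h
      exact hn (if_neg h)
  · intro n
    simp only [F]
    split_ifs with h
    · have hk : Measurable fun p : (Fin m → ℝ) × (Fin m → ℝ) => sssKet n p.1 p.2 := by
        unfold sssKet; fun_prop
      exact ((hk.stronglyMeasurable.mul hg).integral_prod_right').enorm.pow_const 2 |>.aemeasurable
    · exact aemeasurable_const

lemma memLp_sssFun {m : ℕ} (μ : Bits m) (g : Syndrome m) : MemLp (sssFun μ g) 2 volume :=
  ⟨(stronglyMeasurable_sssFun μ g (Lp.stronglyMeasurable g)).aestronglyMeasurable,
    (eLpNorm_sssFun_le μ g (Lp.stronglyMeasurable g)).trans_lt (Lp.eLpNorm_lt_top g)⟩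

lemma ae_residual {m : ℕ} {P : (Fin m → ℝ) × (Fin m → ℝ) → Prop}
    (h : ∀ᵐ p ∂((cellMeasure m).prod (cellMeasure m)), P p) :
    ∀ᵐ x : Fin m → ℝ, ∀ᵐ z₂ ∂(cellMeasure m), P (residual x, z₂) :=
  (quasi_residual m).ae (Measure.ae_ae_of_ae_prod h)

lemma ae_integrable_residual {m : ℕ} (g : Syndrome m) :
    ∀ᵐ x : Fin m → ℝ, Integrable
      (fun z₂ => sssKet (latticeIndex x) (residual x) z₂ * g (residual x, z₂)) (cellMeasure m) := by
  have h1 : Integrable g ((cellMeasure m).prod (cellMeasure m)) :=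
    (Lp.memLp g).integrable (by norm_num)
  filter_upwards [(quasi_residual m).ae h1.prod_right_ae] with x hx
  refine hx.bdd_mul (c := ((Real.sqrt c) ^ m)⁻¹) ?_ (Filter.Eventually.of_forall fun z₂ =>
    (norm_sssKet _ _ _).le)
  refine Measurable.aestronglyMeasurable ?_
  unfold sssKet; fun_prop

/-- The stabilizer subsystem decomposition: `g ↦ |μ⟩ ⊗ g`, an isometry of the syndrome space into
`L²(ℝ^m)`, given by `g ↦ ∫ g(z₁, z₂) |μ; z₁, z₂⟩ dz₁ dz₂`. Together, for all `μ`, these maps identify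
`L²(ℝ^m)` with `(ℂ²)^{⊗m} ⊗ Syndrome m`. -/
def sssIncl {m : ℕ} (μ : Bits m) : Syndrome m →L[ℂ] Mode m :=
  LinearMap.mkContinuous
    { toFun := fun g => (memLp_sssFun μ g).toLp (sssFun μ g)
      map_add' := fun g g' => by
        rw [← MemLp.toLp_add, MemLp.toLp_eq_toLp_iff]
        filter_upwards [ae_residual (Lp.coeFn_add g g'), ae_integrable_residual g,
          ae_integrable_residual g'] with x hx h1 h2
        simp only [sssFun, Pi.add_apply]
        split_ifs
        · rw [← integral_add h1 h2]
          refine integral_congr_ae ?_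
          filter_upwards [hx] with z hz
          rw [hz, Pi.add_apply, mul_add]
        · simp
      map_smul' := fun a g => by
        rw [RingHom.id_apply, ← MemLp.toLp_const_smul, MemLp.toLp_eq_toLp_iff]
        filter_upwards [ae_residual (Lp.coeFn_smul a g)] with x hx
        simp only [sssFun, Pi.smul_apply]
        split_ifs
        · rw [smul_eq_mul, ← integral_const_mul]
          refine integral_congr_ae ?_
          filter_upwards [hx] with z hz
          rw [hz, Pi.smul_apply, smul_eq_mul]; ring
        · simp }
    1 (fun g => by
      rw [one_mul]
      simp only [LinearMap.coe_mk, AddHom.coe_mk, Lp.norm_toLp]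
      exact ENNReal.toReal_mono (Lp.eLpNorm_ne_top g)
        (eLpNorm_sssFun_le μ g (Lp.stronglyMeasurable g)))


/-- The `n`-th Hermite function `(n! √π)^(-1/2) He_n(√2 y) exp(-y² / 2)`, where `He_n` is the
probabilists' Hermite polynomial: the normalized eigenfunction of `(q² + p² - 1) / 2` with
eigenvalue `n`. -/
def hermiteFun (n : ℕ) (y : ℝ) : ℝ :=
  (Real.sqrt (n.factorial * Real.sqrt Real.pi))⁻¹ *
    ((Polynomial.hermite n).map (Int.castRingHom ℝ)).eval (Real.sqrt 2 * y) * Real.exp (-y ^ 2 / 2)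

lemma integrable_poly_gauss (p : Polynomial ℝ) {b : ℝ} (hb : 0 < b) :
    Integrable fun y : ℝ => p.eval y * Real.exp (-b * y ^ 2) := by
  induction p using Polynomial.induction_on' with
  | add p q hp hq =>
    refine (hp.add hq).congr (Filter.Eventually.of_forall fun y => ?_)
    simp only [Polynomial.eval_add, Pi.add_apply]; ring
  | monomial n a =>
    have := (integrable_rpow_mul_exp_neg_mul_sq hb (s := n) (by
      have : (0 : ℝ) ≤ n := n.cast_nonneg
      linarith)).const_mul a
    simpa [mul_assoc] using this

lemma gauss_ibp (p q : Polynomial ℝ) :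
    ∫ y : ℝ, ((Polynomial.X * p - Polynomial.derivative p) * q).eval y * Real.exp (-(1 / 2) * y ^ 2) =
      ∫ y : ℝ, (p * Polynomial.derivative q).eval y * Real.exp (-(1 / 2) * y ^ 2) := by
  have hb : (0 : ℝ) < 1 / 2 := by norm_num
  have i1 := integrable_poly_gauss ((Polynomial.X * p - Polynomial.derivative p) * q) hb
  have i2 := integrable_poly_gauss (p * Polynomial.derivative q) hb
  have i3 := integrable_poly_gauss (p * q) hb
  have hd : ∀ y : ℝ, HasDerivAt (fun y => (p * q).eval y * Real.exp (-(1 / 2) * y ^ 2))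
      ((p * Polynomial.derivative q).eval y * Real.exp (-(1 / 2) * y ^ 2) -
        ((Polynomial.X * p - Polynomial.derivative p) * q).eval y *
          Real.exp (-(1 / 2) * y ^ 2)) y := by
    intro y
    have h1 := (p * q).hasDerivAt y
    have h2 : HasDerivAt (fun y : ℝ => Real.exp (-(1 / 2) * y ^ 2))
        (Real.exp (-(1 / 2) * y ^ 2) * (-y)) y := by
      have := (((hasDerivAt_id y).pow 2).const_mul (-(1 / 2 : ℝ))).exp
      refine this.congr_deriv ?_
      simp
    refine (h1.mul h2).congr_deriv ?_
    simp only [Polynomial.eval_mul, Polynomial.eval_sub, Polynomial.eval_X,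
      Polynomial.derivative_mul, Polynomial.eval_add]
    ring
  have := integral_eq_zero_of_hasDerivAt_of_integrable hd (i2.sub i1) i3
  rw [integral_sub i2 i1] at this
  linarith

lemma gauss_hermite (n : ℕ) (q : Polynomial ℝ) :
    ∫ y : ℝ, (((Polynomial.hermite n).map (Int.castRingHom ℝ)) * q).eval y *
        Real.exp (-(1 / 2) * y ^ 2) =
      ∫ y : ℝ, (Polynomial.derivative^[n] q).eval y * Real.exp (-(1 / 2) * y ^ 2) := by
  induction n generalizing q with
  | zero => simp [Polynomial.hermite_zero]
  | succ n ih =>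
    have : (Polynomial.hermite (n + 1)).map (Int.castRingHom ℝ) =
        Polynomial.X * (Polynomial.hermite n).map (Int.castRingHom ℝ) -
          Polynomial.derivative ((Polynomial.hermite n).map (Int.castRingHom ℝ)) := by
      rw [Polynomial.hermite_succ, Polynomial.map_sub, Polynomial.map_mul, Polynomial.map_X,
        Polynomial.derivative_map]
    rw [this, gauss_ibp, ih, Function.iterate_succ_apply]

lemma natDegree_hermiteR (n : ℕ) :
    ((Polynomial.hermite n).map (Int.castRingHom ℝ)).natDegree = n := by
  rw [(Polynomial.hermite_monic n).natDegree_map, Polynomial.natDegree_hermite]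

lemma gauss_hermite_hermite (n k : ℕ) :
    ∫ y : ℝ, (((Polynomial.hermite n).map (Int.castRingHom ℝ)) *
        ((Polynomial.hermite k).map (Int.castRingHom ℝ))).eval y * Real.exp (-(1 / 2) * y ^ 2) =
      if n = k then n.factorial * Real.sqrt (2 * Real.pi) else 0 := by
  wlog h : k ≤ n generalizing n k
  · rw [mul_comm, this k n (by omega), if_neg (by omega), if_neg (by omega)]
  rw [gauss_hermite]
  split_ifs with hnk
  · subst hnk
    have h0 : (Polynomial.derivative^[n] ((Polynomial.hermite n).map (Int.castRingHom ℝ))) =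
        Polynomial.C (n.factorial : ℝ) := by
      have hd : (Polynomial.derivative^[n]
          ((Polynomial.hermite n).map (Int.castRingHom ℝ))).natDegree ≤ 0 := by
        refine (Polynomial.natDegree_iterate_derivative _ n).trans ?_
        rw [natDegree_hermiteR]; simp
      rw [Polynomial.eq_C_of_natDegree_le_zero hd, Polynomial.coeff_iterate_derivative]
      simp [Polynomial.coeff_hermite_self, Nat.descFactorial_self]
    rw [h0]
    simp only [Polynomial.eval_C]
    rw [integral_const_mul, integral_gaussian]
    congr 2; ring
  · rw [Polynomial.iterate_derivative_eq_zero (by rw [natDegree_hermiteR]; omega)]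
    simp

lemma integral_hermiteFun (n k : ℕ) :
    ∫ y, hermiteFun n y * hermiteFun k y = if n = k then 1 else 0 := by
  set A : ℝ := (Real.sqrt (n.factorial * Real.sqrt Real.pi))⁻¹ with hA
  set B : ℝ := (Real.sqrt (k.factorial * Real.sqrt Real.pi))⁻¹ with hB
  let G : ℝ → ℝ := fun y => (((Polynomial.hermite n).map (Int.castRingHom ℝ)) *
        ((Polynomial.hermite k).map (Int.castRingHom ℝ))).eval y * Real.exp (-(1 / 2) * y ^ 2)
  have h1 : ∀ y, hermiteFun n y * hermiteFun k y = A * B * G (Real.sqrt 2 * y) := by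
    intro y
    simp only [hermiteFun, G, Polynomial.eval_mul]
    have : Real.exp (-(1 / 2) * (Real.sqrt 2 * y) ^ 2) =
        Real.exp (-y ^ 2 / 2) * Real.exp (-y ^ 2 / 2) := by
      rw [← Real.exp_add, mul_pow, Real.sq_sqrt (by norm_num)]; congr 1; ring
    rw [this]; ring
  simp_rw [h1]
  rw [integral_const_mul, Measure.integral_comp_mul_left G (Real.sqrt 2)]
  simp only [G]
  rw [gauss_hermite_hermite]
  split_ifs with h
  · subst h
    have hp : (0 : ℝ) < n.factorial * Real.sqrt Real.pi := by
      have := Real.sqrt_pos.mpr Real.pi_pos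
      positivity
    rw [show A * B = (n.factorial * Real.sqrt Real.pi)⁻¹ by
      rw [hA, hB, ← mul_inv, Real.mul_self_sqrt hp.le], abs_of_pos (by positivity), smul_eq_mul,
      Real.sqrt_mul (by norm_num)]
    have h2 : Real.sqrt 2 ≠ 0 := by positivity
    field_simp
  · simp

lemma hermiteFun_eq (n : ℕ) : hermiteFun n = fun y =>
    (Polynomial.C (Real.sqrt (n.factorial * Real.sqrt Real.pi))⁻¹ *
      ((Polynomial.hermite n).map (Int.castRingHom ℝ)).comp
        (Polynomial.C (Real.sqrt 2) * Polynomial.X)).eval y * Real.exp (-(1 / 2) * y ^ 2) := by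
  funext y
  simp only [hermiteFun, Polynomial.eval_mul, Polynomial.eval_C, Polynomial.eval_comp,
    Polynomial.eval_X]
  congr 2; ring

lemma memLp_poly_gauss (p : Polynomial ℝ) {b : ℝ} (hb : 0 < b) :
    MemLp (fun y : ℝ => p.eval y * Real.exp (-b * y ^ 2)) 2 volume := by
  rw [memLp_two_iff_integrable_sq]
  · have := integrable_poly_gauss (p * p) (b := b + b) (by linarith)
    refine this.congr (Filter.Eventually.of_forall fun y => ?_)
    simp only [Polynomial.eval_mul]
    have h2 : Real.exp (-(b + b) * y ^ 2) = Real.exp (-b * y ^ 2) * Real.exp (-b * y ^ 2) := by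
      rw [← Real.exp_add]; congr 1; ring
    rw [h2]; ring
  · exact (p.continuous.mul (by fun_prop)).aestronglyMeasurable

lemma memLp_hermiteFun (n : ℕ) : MemLp (hermiteFun n) 2 volume := by
  rw [hermiteFun_eq]; exact memLp_poly_gauss _ (by norm_num)

lemma hermite_complete (f : ℝ → ℂ) (hf : MemLp f 2 volume)
    (h : ∀ n, ∫ y, (hermiteFun n y : ℂ) * f y = 0) : f =ᵐ[volume] 0 := by
  have hint : ∀ p : Polynomial ℝ,
      Integrable fun y => ((p.eval y * Real.exp (-(1 / 2) * y ^ 2) : ℝ) : ℂ) * f y := fun p =>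
    ((memLp_poly_gauss p (b := 1 / 2) (by norm_num)).ofReal (K := ℂ)).integrable_mul hf
  -- vanishing of all moments
  let S : Polynomial.Sequence ℝ :=
    { elems' := fun n => Polynomial.C (Real.sqrt (n.factorial * Real.sqrt Real.pi))⁻¹ *
        ((Polynomial.hermite n).map (Int.castRingHom ℝ)).comp
          (Polynomial.C (Real.sqrt 2) * Polynomial.X)
      degree_eq' := fun n => by
        have h1 : (Real.sqrt (n.factorial * Real.sqrt Real.pi))⁻¹ ≠ 0 := by
          have := Real.sqrt_pos.mpr Real.pi_pos
          positivity
        rw [Polynomial.degree_C_mul h1]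
        have hne : ((Polynomial.hermite n).map (Int.castRingHom ℝ)).comp
            (Polynomial.C (Real.sqrt 2) * Polynomial.X) ≠ 0 := by
          intro h0
          have h2 := congrArg (fun p => Polynomial.comp p
            (Polynomial.C (Real.sqrt 2)⁻¹ * Polynomial.X)) h0
          simp only [Polynomial.comp_assoc, Polynomial.mul_comp, Polynomial.C_comp,
            Polynomial.X_comp, Polynomial.zero_comp] at h2
          rw [← mul_assoc, ← Polynomial.C_mul, mul_inv_cancel₀ (by positivity), Polynomial.C_1,
            one_mul, Polynomial.comp_X] at h2
          exact ((Polynomial.hermite_monic n).map (Int.castRingHom ℝ)).ne_zero h2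
        rw [Polynomial.degree_eq_natDegree hne, Polynomial.natDegree_comp, natDegree_hermiteR,
          Polynomial.natDegree_C_mul_X _ (by positivity), mul_one] }
  have hspan : Submodule.span ℝ (Set.range S) = ⊤ :=
    S.span fun i => isUnit_iff_ne_zero.mpr (Polynomial.leadingCoeff_ne_zero.mpr (S.ne_zero i))
  have hmom : ∀ p : Polynomial ℝ,
      ∫ y, ((p.eval y * Real.exp (-(1 / 2) * y ^ 2) : ℝ) : ℂ) * f y = 0 := by
    intro p
    have hp : p ∈ Submodule.span ℝ (Set.range S) := by rw [hspan]; trivial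
    induction hp using Submodule.span_induction with
    | mem x hx =>
      obtain ⟨n, rfl⟩ := hx
      have := h n
      rw [hermiteFun_eq] at this
      exact this
    | zero => simp
    | add p q _ _ hp hq =>
      have := integral_add (hint p) (hint q)
      rw [hp, hq, add_zero] at this
      rw [← this]
      refine integral_congr_ae (Filter.Eventually.of_forall fun y => ?_)
      simp only [Polynomial.eval_add]; push_cast; ring
    | smul a p _ hp =>
      have := integral_const_mul (μ := volume) (a : ℂ)
        fun y => ((p.eval y * Real.exp (-(1 / 2) * y ^ 2) : ℝ) : ℂ) * f y
      rw [hp, mul_zero] at this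
      rw [← this]
      refine integral_congr_ae (Filter.Eventually.of_forall fun y => ?_)
      simp only [Polynomial.eval_smul, smul_eq_mul]; push_cast; ring
  let g : ℝ → ℂ := fun y => (Real.exp (-(1 / 2) * y ^ 2) : ℂ) * f y
  have hg : Integrable g := by simpa [g] using hint 1
  -- the Fourier transform of `g` vanishes
  have hFg : ∀ t : ℝ, ∫ y, Complex.exp (((t * y : ℝ) : ℂ) * Complex.I) * g y = 0 := by
    intro t
    have hs : HasSum (fun n : ℕ => ∫ y, ((((t * y : ℝ) : ℂ) * Complex.I) ^ n / n.factorial) * g y)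
        (∫ y, Complex.exp (((t * y : ℝ) : ℂ) * Complex.I) * g y) := by
      refine hasSum_integral_of_dominated_convergence
        (fun n y => |t * y| ^ n / n.factorial * ‖g y‖) ?_ ?_ ?_ ?_ ?_
      · intro n
        exact (Continuous.aestronglyMeasurable (by fun_prop)).mul hg.aestronglyMeasurable
      · intro n
        refine Filter.Eventually.of_forall fun y => le_of_eq ?_
        rw [norm_mul, norm_div, norm_pow, norm_mul, Complex.norm_I, mul_one, Complex.norm_real,
          Real.norm_eq_abs, Complex.norm_natCast]
      · exact Filter.Eventually.of_forall fun y => (Real.summable_pow_div_factorial _).mul_right _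
      · have h1 : ∀ y, ∑' n : ℕ, |t * y| ^ n / n.factorial * ‖g y‖ =
            Real.exp |t * y| * ‖g y‖ := fun y => by
          rw [tsum_mul_right, Real.exp_eq_exp_ℝ, NormedSpace.exp_eq_tsum_div]
        simp_rw [h1]
        have hM : MemLp (fun y : ℝ => Real.exp (|t * y|) * Real.exp (-(1 / 2) * y ^ 2)) 2
            volume := by
          have := (memLp_poly_gauss (Polynomial.C (Real.exp (t ^ 2))) (b := 1 / 4) (by norm_num))
          refine this.mono (Continuous.aestronglyMeasurable (by fun_prop))
            (Filter.Eventually.of_forall fun y => ?_)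
          rw [Polynomial.eval_C, ← Real.exp_add, ← Real.exp_add, Real.norm_eq_abs,
            Real.norm_eq_abs, abs_of_pos (Real.exp_pos _), abs_of_pos (Real.exp_pos _)]
          refine Real.exp_le_exp.mpr ?_
          have : |t * y| ≤ t ^ 2 + (1 / 4) * y ^ 2 := by
            rw [abs_le]; constructor <;> nlinarith [sq_nonneg (t + y / 2), sq_nonneg (t - y / 2)]
          linarith
        refine (hM.integrable_mul hf.norm).congr (Filter.Eventually.of_forall fun y => ?_)
        simp only [g, Pi.mul_apply]
        rw [norm_mul, Complex.norm_real, Real.norm_of_nonneg (Real.exp_pos _).le]; ring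
      · refine Filter.Eventually.of_forall fun y => HasSum.mul_right _ ?_
        rw [Complex.exp_eq_exp_ℂ]
        exact NormedSpace.expSeries_div_hasSum_exp _
    have h0 : ∀ n : ℕ, ∫ y, ((((t * y : ℝ) : ℂ) * Complex.I) ^ n / n.factorial) * g y = 0 := by
      intro n
      have := hmom (Polynomial.X ^ n)
      have h2 := integral_const_mul (μ := volume) (((t : ℂ) * Complex.I) ^ n / n.factorial)
        fun y => (((Polynomial.X ^ n).eval y * Real.exp (-(1 / 2) * y ^ 2) : ℝ) : ℂ) * f y
      rw [this, mul_zero] at h2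
      rw [← h2]
      refine integral_congr_ae (Filter.Eventually.of_forall fun y => ?_)
      simp only [g, Polynomial.eval_pow, Polynomial.eval_X]; push_cast; ring
    simp_rw [h0] at hs
    exact hs.unique hasSum_zero
  have hF : 𝓕 g = 0 := by
    funext ξ
    rw [Real.fourier_real_eq_integral_exp_smul]
    rw [Pi.zero_apply, ← hFg (-2 * Real.pi * ξ)]
    refine integral_congr_ae (Filter.Eventually.of_forall fun y => ?_)
    simp only [smul_eq_mul]
    congr 3; push_cast; ring
  have hg0 : ∀ᵐ y, g y = 0 := by
    refine ae_eq_zero_of_integral_contDiff_smul_eq_zero hg.locallyIntegrable fun φ hφ hc => ?_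
    have hc' : HasCompactSupport fun y => (φ y : ℂ) := hc.comp_left (g := fun r : ℝ => (r : ℂ)) rfl
    have hφ' : ContDiff ℝ ∞ fun y => (φ y : ℂ) := Complex.ofRealCLM.contDiff.comp hφ
    let Φ : SchwartzMap ℝ ℂ := hc'.toSchwartzMap hφ'
    have h1 : (Φ : SchwartzMap ℝ ℂ) = 𝓕 (𝓕⁻ Φ) := by simp
    have h2 := VectorFourier.integral_fourierIntegral_smul_eq_flip (L := innerₗ ℝ)
      (μ := volume) (ν := volume) Real.continuous_fourierChar continuous_inner
      (SchwartzMap.integrable (𝓕⁻ Φ : SchwartzMap ℝ ℂ) (μ := volume)) hg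
    have h3 : ∀ y, φ y • g y = (𝓕 (𝓕⁻ Φ)) y • g y := fun y => by
      rw [← h1]; rfl
    simp_rw [h3]
    have h4 : VectorFourier.fourierIntegral Real.fourierChar volume (innerₗ ℝ).flip g = 0 := by
      rw [← hF, flip_innerₗ]; rfl
    rw [h4] at h2
    simp only [Pi.zero_apply, smul_zero, integral_zero] at h2
    rw [← h2]
    rfl
  filter_upwards [hg0] with y hy
  have : (Real.exp (-(1 / 2) * y ^ 2) : ℂ) ≠ 0 := by
    exact_mod_cast (Real.exp_pos _).ne'
  simpa [g, this] using hy


lemma fock_preserving : MeasurePreserving (fun x : Fin 1 → ℝ => x 0) :=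
  volume_preserving_funUnique (Fin 1) ℝ

lemma memLp_fock (n : ℕ) : MemLp (fun x : Fin 1 → ℝ => (hermiteFun n (x 0) : ℂ)) 2 volume :=
  ((memLp_hermiteFun n).ofReal (K := ℂ)).comp_measurePreserving fock_preserving

/-- The number state `|n⟩` of one mode. -/
def fock (n : ℕ) : Mode 1 := (memLp_fock n).toLp _

lemma orthonormal_fock : Orthonormal ℂ fock := by
  rw [orthonormal_iff_ite]
  intro n k
  rw [L2.inner_def]
  have h1 : ∫ x, ⟪fock n x, fock k x⟫_ℂ =
      ∫ x : Fin 1 → ℝ, ((hermiteFun n (x 0) * hermiteFun k (x 0) : ℝ) : ℂ) := by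
    refine integral_congr_ae ?_
    filter_upwards [(memLp_fock n).coeFn_toLp, (memLp_fock k).coeFn_toLp] with x h1 h2
    rw [fock, fock, h1, h2, RCLike.inner_apply, Complex.conj_ofReal, mul_comm, Complex.ofReal_mul]
  have h2 := (volume_preserving_funUnique (Fin 1) ℝ).integral_comp'
    (g := fun y : ℝ => ((hermiteFun n y * hermiteFun k y : ℝ) : ℂ))
  rw [h1]
  refine h2.trans ?_
  rw [integral_complex_ofReal, integral_hermiteFun]
  split_ifs <;> simp

lemma fock_orthogonal : (Submodule.span ℂ (Set.range fock))ᗮ = ⊥ := by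
  rw [Submodule.eq_bot_iff]
  intro ψ hψ
  have hmp := (volume_preserving_funUnique (Fin 1) ℝ).symm
  have hf : MemLp (fun y : ℝ => ψ ((MeasurableEquiv.funUnique (Fin 1) ℝ).symm y)) 2 volume :=
    (Lp.memLp ψ).comp_measurePreserving hmp
  have h0 := hermite_complete _ hf fun n => by
    have h1 : ⟪fock n, ψ⟫_ℂ = 0 := hψ _ (Submodule.subset_span ⟨n, rfl⟩)
    rw [L2.inner_def] at h1
    rw [← h1]
    refine Eq.trans ?_ (hmp.integral_comp' (g := fun x => ⟪fock n x, ψ x⟫_ℂ))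
    refine integral_congr_ae ?_
    filter_upwards [hmp.quasiMeasurePreserving.ae (memLp_fock n).coeFn_toLp] with y hy
    rw [fock, hy, RCLike.inner_apply, Complex.conj_ofReal, mul_comm]
    rfl
  refine Lp.ext ?_
  have h1 := (volume_preserving_funUnique (Fin 1) ℝ).quasiMeasurePreserving.ae h0
  filter_upwards [h1, Lp.coeFn_zero ℂ 2 (volume : Measure (Fin 1 → ℝ))] with x hx hz
  rw [hz]
  rw [MeasurableEquiv.symm_apply_apply] at hx
  simpa using hx

/-- The number states form a Hilbert basis. -/
def fockBasis : HilbertBasis ℕ ℂ (Mode 1) :=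
  HilbertBasis.mkOfOrthogonalEqBot orthonormal_fock fock_orthogonal

lemma orthonormal_phase_fock (θ : ℝ) :
    Orthonormal ℂ fun n : ℕ => Complex.exp (Complex.I * (θ * n : ℝ)) • fock n := by
  have h : ∀ n : ℕ, ‖Complex.exp (Complex.I * (θ * n : ℝ))‖ = 1 := fun n => by
    rw [mul_comm, Complex.norm_exp_ofReal_mul_I]
  refine ⟨fun n => ?_, fun n k hnk => ?_⟩
  · rw [norm_smul, h, orthonormal_fock.1 n, one_mul]
  · change ⟪_ • fock n, _ • fock k⟫_ℂ = 0
    rw [inner_smul_left, inner_smul_right, orthonormal_fock.2 hnk, mul_zero, mul_zero]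

/-- The phase rotation `R(θ) = exp(i θ n̂) = ∑ n, exp(i θ n) |n⟩⟨n|`. -/
def rotation (θ : ℝ) : Mode 1 →L[ℂ] Mode 1 :=
  ((orthonormal_phase_fock θ).orthogonalFamily.linearIsometry.comp
    fockBasis.repr.toLinearIsometry).toContinuousLinearMap

lemma rotation_apply (θ : ℝ) (ψ : Mode 1) :
    rotation θ ψ = ∑' n : ℕ, ⟪fock n, ψ⟫_ℂ • Complex.exp (Complex.I * (θ * n : ℝ)) • fock n := by
  have h : ∀ n, fock n = fockBasis n := fun n => by simp [fockBasis]
  simp only [h, ← HilbertBasis.repr_apply_apply]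
  simp only [rotation, h]
  rfl

lemma memLp_phase {m : ℕ} (v₁ v₂ : Fin m → ℝ) : MemLp (fun x : Fin m → ℝ =>
    Complex.exp (Complex.I * ((∑ i, (v₂ i * x i - v₁ i * v₂ i / 2) : ℝ) : ℂ))) ∞ volume := by
  refine memLp_top_of_bound (Continuous.aestronglyMeasurable (by fun_prop)) 1
    (Filter.Eventually.of_forall fun x => ?_)
  rw [mul_comm, Complex.norm_exp_ofReal_mul_I]

/-- The displacement `V(v₁, v₂) = exp(-i (v₁ · p - v₂ · q))`, that is
`(V(v₁, v₂) ψ)(x) = exp(i (v₂ · x - v₁ · v₂ / 2)) ψ(x - v₁)`; on `m` modes it is the tensor product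
of the single-mode displacements. -/
def displacement {m : ℕ} (v₁ v₂ : Fin m → ℝ) : Mode m →L[ℂ] Mode m :=
  mulOp volume (fun x =>
      Complex.exp (Complex.I * ((∑ i, (v₂ i * x i - v₁ i * v₂ i / 2) : ℝ) : ℂ)))
    (memLp_phase v₁ v₂) ∘L
  (Lp.compMeasurePreservingₗᵢ ℂ (fun x : Fin m → ℝ => x - v₁)
    (measurePreserving_sub_right volume v₁)).toContinuousLinearMap

lemma shear_preserving :
    MeasurePreserving (fun x : Fin 2 → ℝ => ![x 0, x 1 - x 0]) := by
  have h := Real.volume_preserving_transvectionStruct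
    (⟨1, 0, by decide, -1⟩ : Matrix.TransvectionStruct (Fin 2) ℝ)
  convert h using 1
  funext x i
  fin_cases i
  · simp [Matrix.TransvectionStruct.toMatrix, Matrix.transvection, Matrix.toLin'_apply,
      Matrix.single]
  · simp [Matrix.TransvectionStruct.toMatrix, Matrix.transvection, Matrix.toLin'_apply,
      Matrix.single]
    ring

/-- The SUM gate `exp(-i q₁ p₂)`, which translates the second position by the first:
`(SUM ψ)(x₁, x₂) = ψ(x₁, x₂ - x₁)`. -/
def sumGate : Mode 2 →L[ℂ] Mode 2 :=
  (Lp.compMeasurePreservingₗᵢ ℂ (fun x : Fin 2 → ℝ => ![x 0, x 1 - x 0])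
    shear_preserving).toContinuousLinearMap

/-- The region `|z₁|, |z₂| < r` of the cell, with the radius `r i` for the mode `i`. -/
def square {m : ℕ} (r : Fin m → ℝ) : Set ((Fin m → ℝ) × (Fin m → ℝ)) :=
  {z | ∀ i, |z.1 i| < r i ∧ |z.2 i| < r i}

lemma measurableSet_square {m : ℕ} (r : Fin m → ℝ) : MeasurableSet (square r) := by
  have : square r = ⋂ i, {z | |z.1 i| < r i ∧ |z.2 i| < r i} := by
    ext z; simp [square]
  rw [this]
  refine MeasurableSet.iInter fun i => ?_
  have h1 : MeasurableSet {z : (Fin m → ℝ) × (Fin m → ℝ) | |z.1 i| < r i} :=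
    (isOpen_lt (by fun_prop) (by fun_prop)).measurableSet
  have h2 : MeasurableSet {z : (Fin m → ℝ) × (Fin m → ℝ) | |z.2 i| < r i} :=
    (isOpen_lt (by fun_prop) (by fun_prop)).measurableSet
  exact h1.inter h2

lemma memLp_square {m : ℕ} (r : Fin m → ℝ) :
    MemLp ((square r).indicator (1 : (Fin m → ℝ) × (Fin m → ℝ) → ℂ)) ∞
      ((cellMeasure m).prod (cellMeasure m)) :=
  (memLp_top_const (1 : ℂ)).indicator (measurableSet_square r)

/-- The filter `⨂ i, Π_{r i}`: the identity on the logical qubits, tensored with the projection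
onto the functions on the cell supported in `|z₁|, |z₂| < r i`. -/
def sssFilter {m : ℕ} (r : Fin m → ℝ) : Mode m →L[ℂ] Mode m :=
  ∑ μ : Bits m, sssIncl μ ∘L
    mulOp ((cellMeasure m).prod (cellMeasure m)) ((square r).indicator 1) (memLp_square r) ∘L
    ContinuousLinearMap.adjoint (sssIncl μ)

section HilbertSpace

variable {E : Type*} [NormedAddCommGroup E] [InnerProductSpace ℂ E] [CompleteSpace E]

/-- The map `T ↦ A T A†`. -/
def conjBy (A T : E →L[ℂ] E) : E →L[ℂ] E := A ∘L T ∘L ContinuousLinearMap.adjoint A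

/-- Trace-class operators: norm-convergent sums `∑ k, |a k⟩⟨b k|` with `∑ k, ‖a k‖ ‖b k‖ < ∞`. -/
def IsTraceClass (T : E →L[ℂ] E) : Prop :=
  ∃ a b : ℕ → E, Summable (fun k => ‖a k‖ * ‖b k‖) ∧
    HasSum (fun k => InnerProductSpace.rankOne ℂ (a k) (b k)) T

/-- The trace `∑ i, ⟪b i, T (b i)⟫` over a Hilbert basis `b`. For trace-class `T` the sum converges
and does not depend on the basis. -/
def opTrace (T : E →L[ℂ] E) : ℂ :=
  ∑' i, ⟪(exists_hilbertBasis ℂ E).choose_spec.choose i,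
    T ((exists_hilbertBasis ℂ E).choose_spec.choose i)⟫_ℂ

end HilbertSpace

/-- The ideal decoder: the partial trace over the syndrome space, with the entries
`Tr (⟨μ| T |ν⟩)`. -/
def decoder {m : ℕ} (T : Mode m →L[ℂ] Mode m) : Matrix (Bits m) (Bits m) ℂ :=
  Matrix.of fun μ ν => opTrace (ContinuousLinearMap.adjoint (sssIncl μ) ∘L T ∘L sssIncl ν)

/-- Finite linear combinations of the displacements with all components in `[-s, s)`. -/
def displacementSpan (m : ℕ) (s : ℝ) : Submodule ℂ (Mode m →L[ℂ] Mode m) :=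
  Submodule.span ℂ {A | ∃ v₁ v₂ : Fin m → ℝ,
    (∀ i, v₁ i ∈ Set.Ico (-s) s ∧ v₂ i ∈ Set.Ico (-s) s) ∧ A = displacement v₁ v₂}

/-- Linear combinations of displacements with components in `[-s, s)`, in the general sense: limits
of finite linear combinations in the weak operator topology. These include all the weak integrals
`∫ κ(z) V(z) dz` against integrable functions, or against complex measures, supported in this set. -/
def IsDisplacementCombination {m : ℕ} (s : ℝ) (A : Mode m →L[ℂ] Mode m) : Prop :=
  ContinuousLinearMapWOT.ofCLM A ∈ closure
    (ContinuousLinearMapWOT.ofCLM '' (displacementSpan m s : Set (Mode m →L[ℂ] Mode m)))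

/-- An `s`-parameterized noise channel: a completely positive trace-preserving map
`N(T) = ∑ k, K k T (K k)†` whose Kraus operators `K k` are linear combinations of displacements with
components in `[-s, s)`. The second clause is `∑ k, (K k)† K k = 1`. Only the values of `N` on
trace-class operators matter. -/
def IsNoiseChannel {m : ℕ} (s : ℝ)
    (N : (Mode m →L[ℂ] Mode m) → (Mode m →L[ℂ] Mode m)) : Prop :=
  ∃ K : ℕ → (Mode m →L[ℂ] Mode m),
    (∀ k, IsDisplacementCombination s (K k)) ∧
    (∀ ψ, HasSum (fun k => ‖K k ψ‖ ^ 2) (‖ψ‖ ^ 2)) ∧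
    ∀ T, IsTraceClass T → HasSum (fun k => conjBy (K k) T) (N T)

/-- The qubit gates, indexed by the number of qubits. -/
inductive Gate : ℕ → Type
  | X : Gate 1
  | Z : Gate 1
  | H : Gate 1
  | I : Gate 1
  | CNOT : Gate 2

/-- The operators on the modes that implement the gates. -/
def Gate.physical : {m : ℕ} → Gate m → (Mode m →L[ℂ] Mode m)
  | _, .X => displacement (fun _ => c) (fun _ => 0)
  | _, .Z => displacement (fun _ => 0) (fun _ => c)
  | _, .H => rotation (Real.pi / 2)
  | _, .I => ContinuousLinearMap.id ℂ _
  | _, .CNOT => sumGate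

/-- A `2 × 2` matrix as a matrix indexed by the labels of one qubit. -/
def oneQubit (M : Matrix (Fin 2) (Fin 2) ℂ) : Matrix (Bits 1) (Bits 1) ℂ :=
  Matrix.of fun μ ν => M (μ 0) (ν 0)

/-- The qubit unitaries; the first qubit controls `CNOT`. -/
def Gate.logical : {m : ℕ} → Gate m → Matrix (Bits m) (Bits m) ℂ
  | _, .X => oneQubit !![0, 1; 1, 0]
  | _, .Z => oneQubit !![1, 0; 0, -1]
  | _, .H => oneQubit ((Real.sqrt 2 : ℂ)⁻¹ • !![1, 1; 1, -1])
  | _, .I => 1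
  | _, .CNOT => Matrix.of fun μ ν => if μ 0 = ν 0 ∧ μ 1 = ν 0 + ν 1 then 1 else 0

/-- The noisy gate: `T ↦ U T U†` followed by the noise channel. -/
def sGate {m : ℕ} (U : Gate m) (N : (Mode m →L[ℂ] Mode m) → (Mode m →L[ℂ] Mode m))
    (T : Mode m →L[ℂ] Mode m) : Mode m →L[ℂ] Mode m :=
  N (conjBy U.physical T)

end GKP

end

noncomputable section

open MeasureTheory
open scoped ENNReal InnerProductSpace ComplexConjugate FourierTransform ContDiff

namespace GKP

/-! The maps `sssIncl μ` are isometries with mutually orthogonal ranges. For fixed `z₁`, the values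
of the wave function at the positions `z₁ + c n`, with `n` of parity `μ`, are Fourier coefficients
in `z₂` of the syndrome function times a phase, so Parseval on the cell (`parseval_cell`) gives
`norm_sssIncl`. Different parities give disjoint supports (`inner_sssIncl_of_ne`). Completeness of
the ranges is not needed, because the input is filtered.

Everything reduces to one property, `ActsAs`: on states supported in a small square the operator is
a qubit matrix tensored with some map of syndromes, and the new syndrome lies in a slightly larger
square. As long as that square fits in the cell, no remainder wraps around, so the syndrome errors
never turn into logical errors.

For displacements, X, Z and SUM this is a change of variables on generalized states
(`exists_sssIncl_of_monomial`): positions and quasi-momenta are shifted or sheared, the lattice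
index is permuted, and the leftover phase does not see the logical state. For a displacement the
dependence on the lattice index cancels entirely, so it is logically the identity. SUM adds
remainders, hence the sum of the radii.

The rotation is defined by its number-state expansion. Hermite functions are eigenfunctions of the
Fourier integral (`integral_exp_mul_hermiteFun`), so the rotation by `π / 2` is a Fourier transform
on integrable functions. A wave packet on a single lattice site is transformed explicitly, and such
packets are total, so the rotation is Hadamard tensored with a quarter turn of the syndrome square
(`rotation_sssIncl`).

A Kraus operator is a weak limit of combinations of displacements. Acting as the identity tensored
with something, and landing in the larger square, are linear relations between matrix elements; they
survive the limit (`IsDisplacementCombination.exists_sssIncl`).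

Gate A follows because the larger filter fixes the output of every Kraus term. For Gate B, the
trace-class input is an absolutely convergent sum of rank-one terms. Trace preservation, tested on
one logical basis state, says that the syndrome factors of the Kraus operators preserve inner
products on average, so they drop out of the partial trace and only conjugation by the qubit matrix
remains (`decoder_of_actsAs`). -/

section Torus

-- Fourier series on the cell and the norm of an encoded syndrome function.

local instance : MeasureSpace UnitAddCircle := ⟨AddCircle.haarAddCircle⟩

/-- The torus is parametrized by boxes closed on the right, the cell is closed on the left; the
difference is a null set. -/
lemma cell_ae_eq_Ioc (m : ℕ) :
    cell m =ᵐ[volume] {z : Fin m → ℝ | ∀ i, z i ∈ Set.Ioc (-(c / 2)) (c / 2)} := by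
  have h1 := Measure.univ_pi_Ico_ae_eq_Icc (μ := fun _ : Fin m => (volume : Measure ℝ))
    (f := fun _ => -(c / 2)) (g := fun _ => c / 2)
  have h2 := Measure.univ_pi_Ioc_ae_eq_Icc (μ := fun _ : Fin m => (volume : Measure ℝ))
    (f := fun _ => -(c / 2)) (g := fun _ => c / 2)
  have h3 : {z : Fin m → ℝ | ∀ i, z i ∈ Set.Ioc (-(c / 2)) (c / 2)} =
      Set.univ.pi fun _ => Set.Ioc (-(c / 2)) (c / 2) := by ext z; simp
  rw [h3]
  exact h1.trans h2.symm

open scoped Pointwise in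
lemma smul_unitBox (m : ℕ) :
    c • {x : Fin m → ℝ | ∀ i, x i ∈ Set.Ioc (-(1 / 2) : ℝ) (-(1 / 2) + 1)} =
      {z : Fin m → ℝ | ∀ i, z i ∈ Set.Ioc (-(c / 2)) (c / 2)} := by
  have hc := c_pos
  ext z
  rw [Set.mem_smul_set_iff_inv_smul_mem₀ hc.ne']
  simp only [Set.mem_ofPred_eq, Pi.smul_apply, smul_eq_mul, Set.mem_Ioc]
  refine forall_congr' fun i => ?_
  rw [← div_eq_inv_mul, lt_div_iff₀ hc, div_le_iff₀ hc]
  constructor <;> rintro ⟨h1, h2⟩ <;> constructor <;> linarith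

lemma integral_unitBox {m : ℕ} {E : Type*} [NormedAddCommGroup E] [NormedSpace ℝ E]
    (f : (Fin m → ℝ) → E) :
    ∫ x in {x : Fin m → ℝ | ∀ i, x i ∈ Set.Ioc (-(1 / 2) : ℝ) (-(1 / 2) + 1)}, f (c • x) =
      (c ^ m)⁻¹ • ∫ z, f z ∂(cellMeasure m) := by
  have hc := c_pos
  rw [Measure.setIntegral_comp_smul _ _ _ hc.ne', smul_unitBox,
    ← setIntegral_congr_set (cell_ae_eq_Ioc m)]
  simp [abs_of_pos hc]

lemma memLp_unitBox {m : ℕ} {φ : (Fin m → ℝ) → ℂ} (hφ : StronglyMeasurable φ)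
    (hL : MemLp φ 2 (cellMeasure m)) :
    MemLp (fun x => φ (c • x)) 2 (volume.restrict
      {x : Fin m → ℝ | ∀ i, x i ∈ Set.Ioc (-(1 / 2) : ℝ) (-(1 / 2) + 1)}) := by
  have hc := c_pos
  have hm : ∀ a b : ℝ, MeasurableSet {z : Fin m → ℝ | ∀ i, z i ∈ Set.Ioc a b} := fun a b => by
    have : {z : Fin m → ℝ | ∀ i, z i ∈ Set.Ioc a b} = Set.univ.pi fun _ => Set.Ioc a b := by
      ext z; simp
    rw [this]
    exact MeasurableSet.univ_pi fun _ => measurableSet_Ioc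
  have hs : StronglyMeasurable fun x : Fin m → ℝ => φ (c • x) :=
    hφ.comp_measurable (measurable_const_smul c)
  rw [memLp_two_iff_integrable_sq_norm hs.aestronglyMeasurable]
  have h1 := (memLp_two_iff_integrable_sq_norm hφ.aestronglyMeasurable).mp hL
  have h2 : IntegrableOn (fun z => ‖φ z‖ ^ 2)
      {z : Fin m → ℝ | ∀ i, z i ∈ Set.Ioc (-(c / 2)) (c / 2)} :=
    (integrableOn_congr_set_ae (cell_ae_eq_Ioc m)).mp h1
  rw [← integrable_indicator_iff (hm _ _)] at h2
  have h3 := h2.comp_smul hc.ne'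
  change IntegrableOn _ _ _
  rw [← integrable_indicator_iff (hm _ _)]
  refine h3.congr (Filter.Eventually.of_forall fun x => ?_)
  have h4 : c • x ∈ {z : Fin m → ℝ | ∀ i, z i ∈ Set.Ioc (-(c / 2)) (c / 2)} ↔
      x ∈ {x : Fin m → ℝ | ∀ i, x i ∈ Set.Ioc (-(1 / 2) : ℝ) (-(1 / 2) + 1)} := by
    rw [← smul_unitBox]
    exact Set.smul_mem_smul_set_iff₀ hc.ne' _ _
  by_cases hx : x ∈ {x : Fin m → ℝ | ∀ i, x i ∈ Set.Ioc (-(1 / 2) : ℝ) (-(1 / 2) + 1)}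
  · dsimp only
    rw [Set.indicator_of_mem (h4.mpr hx), Set.indicator_of_mem hx]
  · dsimp only
    rw [Set.indicator_of_notMem (fun h => hx (h4.mp h)), Set.indicator_of_notMem hx]

/-- Parseval's identity for the multiple Fourier series on the cell. -/
lemma hasSum_sq_integral_exp_cell {m : ℕ} {φ : (Fin m → ℝ) → ℂ} (hφ : StronglyMeasurable φ)
    (hL : MemLp φ 2 (cellMeasure m)) :
    HasSum (fun n : Fin m → ℤ => ‖∫ z, Complex.exp (-(Complex.I *
        ((∑ i, c * (2 * n i) * z i : ℝ) : ℂ))) * φ z ∂(cellMeasure m)‖ ^ 2)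
      (c ^ m * ∫ z, ‖φ z‖ ^ 2 ∂(cellMeasure m)) := by
  have hc := c_pos
  -- Base corner of the unit fundamental domain, chosen so that scaling by `c` gives the cell up to
  -- a null set.
  let b : Fin m → ℝ := fun _ => -(1 / 2)
  let S : UnitAddTorus (Fin m) → (Fin m → ℝ) := fun t =>
    (UnitAddTorus.measurableEquivPiIoc b t).1
  have hSm : Measurable S :=
    measurable_subtype_coe.comp (UnitAddTorus.measurableEquivPiIoc b).measurable
  have hS : ∀ x : Fin m → ℝ, (∀ i, x i ∈ Set.Ioc (b i) (b i + 1)) →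
      S (fun i => (x i : UnitAddCircle)) = x := fun x hx => by
    funext i
    simp only [S, UnitAddTorus.coe_measurableEquivPiIoc_apply]
    rw [AddCircle.equivIoc_coe_eq (hx i)]
  let Φ : UnitAddTorus (Fin m) → ℂ := fun t => φ (c • S t)
  have hΦm : StronglyMeasurable Φ := hφ.comp_measurable (hSm.const_smul c)
  have hbox : MeasurableSet {x : Fin m → ℝ | ∀ i, x i ∈ Set.Ioc (b i) (b i + 1)} := by
    have : {x : Fin m → ℝ | ∀ i, x i ∈ Set.Ioc (b i) (b i + 1)} =
        Set.univ.pi fun i => Set.Ioc (b i) (b i + 1) := by ext z; simp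
    rw [this]
    exact MeasurableSet.univ_pi fun _ => measurableSet_Ioc
  have hΦ : MemLp Φ 2 volume := by
    refine ⟨hΦm.aestronglyMeasurable, ?_⟩
    have h1 := (memLp_unitBox hφ hL).2
    rw [eLpNorm_lt_top_iff_lintegral_rpow_enorm_lt_top (by simp) (by simp)] at h1 ⊢
    rw [UnitAddTorus.lintegral_preimage _ b]
    refine lt_of_le_of_lt (le_of_eq ?_) h1
    refine setLIntegral_congr_fun hbox fun x hx => ?_
    simp only [Φ, hS x hx]
  have hmain := UnitAddTorus.hasSum_sq_mFourierCoeff (hΦ.toLp Φ)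
  have hcoef : ∀ n : Fin m → ℤ, UnitAddTorus.mFourierCoeff (hΦ.toLp Φ) n =
      (c ^ m)⁻¹ • ∫ z, Complex.exp (-(Complex.I *
        ((∑ i, c * (2 * n i) * z i : ℝ) : ℂ))) * φ z ∂(cellMeasure m) := fun n => by
    have h1 : UnitAddTorus.mFourierCoeff (hΦ.toLp Φ) n = UnitAddTorus.mFourierCoeff Φ n :=
      integral_congr_ae (by
        filter_upwards [hΦ.coeFn_toLp] with t ht
        rw [ht])
    rw [h1, UnitAddTorus.mFourierCoeff_eq_integral _ _ b, ← integral_unitBox]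
    refine setIntegral_congr_fun hbox fun x hx => ?_
    simp only [Φ, hS x hx, smul_eq_mul]
    congr 1
    simp only [UnitAddTorus.mFourier, ContinuousMap.coe_mk, fourier_coe_apply, ← Complex.exp_sum]
    congr 1
    push_cast
    rw [Finset.mul_sum, ← Finset.sum_neg_distrib]
    refine Finset.sum_congr rfl fun i _ => ?_
    simp only [Pi.neg_apply, Pi.smul_apply, smul_eq_mul]
    -- This is where `c = √π` enters: at `z = c x` the frequency `2 c n` becomes the torus frequency
    -- `2π n`.
    rw [← c_sq]
    push_cast
    ring
  have hnorm : ∫ t, ‖(hΦ.toLp Φ) t‖ ^ 2 = (c ^ m)⁻¹ • ∫ z, ‖φ z‖ ^ 2 ∂(cellMeasure m) := by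
    have h1 : ∫ t, ‖(hΦ.toLp Φ) t‖ ^ 2 = ∫ t, ‖Φ t‖ ^ 2 :=
      integral_congr_ae (by
        filter_upwards [hΦ.coeFn_toLp] with t ht
        rw [ht])
    rw [h1, UnitAddTorus.integral_preimage _ b, ← integral_unitBox]
    refine setIntegral_congr_fun hbox fun x hx => ?_
    simp only [Φ, hS x hx]
  rw [hnorm] at hmain
  simp_rw [hcoef] at hmain
  have hcm : (0 : ℝ) < c ^ m := pow_pos hc m
  -- The coefficients carry a factor `c ^ (-m)`, squared here, while the integral carries it once;
  -- hence the factor `c ^ m` that remains.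
  have h2 := hmain.mul_left ((c ^ m) ^ 2)
  have h3 : (c ^ m) ^ 2 * (c ^ m)⁻¹ • ∫ z, ‖φ z‖ ^ 2 ∂(cellMeasure m) =
      c ^ m * ∫ z, ‖φ z‖ ^ 2 ∂(cellMeasure m) := by
    rw [smul_eq_mul]; field_simp
  rw [h3] at h2
  refine h2.congr_fun fun n => ?_
  rw [norm_smul, norm_inv, Real.norm_of_nonneg hcm.le]
  field_simp

end Torus

/-- Parseval's identity for the exponentials whose frequencies have a fixed parity. -/
lemma parseval_cell {m : ℕ} (μ : Bits m) {φ : (Fin m → ℝ) → ℂ} (hφ : StronglyMeasurable φ)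
    (hL : MemLp φ 2 (cellMeasure m)) :
    ∑' n : {n : Fin m → ℤ // matchesBits n μ},
      ‖∫ z, conj (cellChar n.1 z) * φ z ∂(cellMeasure m)‖ₑ ^ 2 =
        ∫⁻ z, ‖φ z‖ₑ ^ 2 ∂(cellMeasure m) := by
  have hc := c_pos
  -- Modulation by the parity vector moves the frequencies of parity `μ` onto the even ones, where
  -- the full Fourier series applies.
  let p : (Fin m → ℝ) → ℂ := fun z =>
    Complex.exp (((∑ i, c * ((μ i : ℕ) : ℝ) * z i : ℝ) : ℂ) * Complex.I)
  have hp : Continuous p := by fun_prop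
  have hpn : ∀ z, ‖p z‖ = 1 := fun z => Complex.norm_exp_ofReal_mul_I _
  have hψ : StronglyMeasurable fun z => p z * φ z := hp.stronglyMeasurable.mul hφ
  have hψn : ∀ z, ‖p z * φ z‖ = ‖φ z‖ := fun z => by rw [norm_mul, hpn, one_mul]
  have hψL : MemLp (fun z => p z * φ z) 2 (cellMeasure m) :=
    hL.of_le hψ.aestronglyMeasurable (Filter.Eventually.of_forall fun z => (hψn z).le)
  have hsum := (hasSum_sq_integral_exp_cell hψ hψL).mul_left ((c ^ m)⁻¹)
  -- The sign is reversed because the conjugate of `cellChar` has a positive exponent and Fourier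
  -- coefficients a negative one.
  let e : (Fin m → ℤ) ≃ {n : Fin m → ℤ // matchesBits n μ} :=
    { toFun := fun n => ⟨fun i => ((μ i : ℕ) : ℤ) - 2 * n i, fun i => by
        have := (μ i).isLt
        dsimp only
        omega⟩
      invFun := fun n i => (((μ i : ℕ) : ℤ) - n.1 i) / 2
      left_inv := fun n => by funext i; simp
      right_inv := fun n => by
        ext i
        have := n.2 i
        dsimp only
        omega }
  rw [← e.tsum_eq]
  have hterm : ∀ n : Fin m → ℤ,
      ‖∫ z, conj (cellChar (e n).1 z) * φ z ∂(cellMeasure m)‖ₑ ^ 2 =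
        ENNReal.ofReal ((c ^ m)⁻¹ * ‖∫ z, Complex.exp (-(Complex.I *
        ((∑ i, c * (2 * n i) * z i : ℝ) : ℂ))) * (p z * φ z) ∂(cellMeasure m)‖ ^ 2) := fun n => by
    have h1 : ∀ z, conj (cellChar (e n).1 z) * φ z = (((Real.sqrt c) ^ m : ℝ)⁻¹ : ℂ) *
        (Complex.exp (-(Complex.I * ((∑ i, c * (2 * n i) * z i : ℝ) : ℂ))) * (p z * φ z)) := by
      intro z
      simp only [cellChar, map_mul, ← Complex.exp_conj, map_neg, Complex.conj_I,
        Complex.conj_ofReal, p]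
      rw [← mul_assoc (Complex.exp _), ← Complex.exp_add, mul_assoc]
      congr 2
      · simp
      congr 1
      simp only [e, Equiv.coe_fn_mk]
      push_cast
      rw [mul_comm _ Complex.I, neg_mul, neg_neg, ← mul_neg, ← mul_add, ← Finset.sum_neg_distrib,
        ← Finset.sum_add_distrib]
      congr 1
      exact Finset.sum_congr rfl fun i _ => by ring
    simp_rw [h1]
    rw [integral_const_mul, ← ofReal_norm, ← ENNReal.ofReal_pow (norm_nonneg _), norm_mul, mul_pow]
    congr 2
    rw [norm_inv, Complex.norm_real, Real.norm_of_nonneg (by positivity), inv_pow, ← pow_mul,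
      mul_comm m 2, pow_mul, Real.sq_sqrt hc.le]
  simp_rw [hterm]
  rw [← ENNReal.ofReal_tsum_of_nonneg (fun _ => by positivity) hsum.summable, hsum.tsum_eq,
    ← mul_assoc, inv_mul_cancel₀ (pow_pos hc m).ne', one_mul, ofReal_integral_eq_lintegral_ofReal
    ((memLp_two_iff_integrable_sq_norm hψL.1).mp hψL) (Filter.Eventually.of_forall fun z => by
      simp only [Pi.zero_apply]; positivity)]
  refine lintegral_congr fun z => ?_
  rw [hψn, ENNReal.ofReal_pow (norm_nonneg _), ofReal_norm]

/-- Parseval is applied on each fibre of fixed `z₁`, where the values at the lattice translates of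
`z₁` are the Fourier coefficients, and the result is integrated over `z₁`. Square integrability of
`g` provides almost every fibre with the same property. -/
lemma eLpNorm_sssFun {m : ℕ} (μ : Bits m) {g : (Fin m → ℝ) × (Fin m → ℝ) → ℂ}
    (hg : StronglyMeasurable g) (hL : MemLp g 2 ((cellMeasure m).prod (cellMeasure m))) :
    eLpNorm (sssFun μ g) 2 volume = eLpNorm g 2 ((cellMeasure m).prod (cellMeasure m)) := by
  classical
  rw [eLpNorm_eq_lintegral_rpow_enorm_toReal (by simp) (by simp),
    eLpNorm_eq_lintegral_rpow_enorm_toReal (by simp) (by simp)]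
  congr 1
  simp only [ENNReal.toReal_ofNat, ENNReal.rpow_ofNat]
  let F : (Fin m → ℤ) → (Fin m → ℝ) → ℝ≥0∞ := fun n z₁ =>
    if matchesBits n μ then ‖∫ z₂, sssKet n z₁ z₂ * g (z₁, z₂) ∂(cellMeasure m)‖ₑ ^ 2 else 0
  have h1 : ∀ x, ‖sssFun μ g x‖ₑ ^ 2 = F (latticeIndex x) (residual x) := fun x => by
    simp only [sssFun, F]; split_ifs <;> simp
  simp_rw [h1]
  rw [lintegral_wrap, lintegral_prod _ (hg.enorm.pow_const 2).aemeasurable,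
    ← lintegral_tsum]
  · have hfib : ∀ᵐ z₁ ∂(cellMeasure m), Integrable (fun z₂ => ‖g (z₁, z₂)‖ ^ 2) (cellMeasure m) :=
      ((memLp_two_iff_integrable_sq_norm hg.aestronglyMeasurable).mp hL).prod_right_ae
    refine lintegral_congr_ae ?_
    filter_upwards [hfib] with z₁ hz₁
    let p : (Fin m → ℝ) → ℂ := fun z₂ =>
      Complex.exp (((∑ i, z₂ i * z₁ i / 2 : ℝ) : ℂ) * Complex.I)
    have hgz : StronglyMeasurable fun z₂ => g (z₁, z₂) :=
      hg.comp_measurable measurable_prodMk_left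
    have hφ : StronglyMeasurable fun z₂ => p z₂ * g (z₁, z₂) :=
      (Continuous.stronglyMeasurable (by fun_prop)).mul hgz
    have hn : ∀ z₂, ‖p z₂ * g (z₁, z₂)‖ = ‖g (z₁, z₂)‖ := fun z₂ => by
      rw [norm_mul, Complex.norm_exp_ofReal_mul_I, one_mul]
    have hφL : MemLp (fun z₂ => p z₂ * g (z₁, z₂)) 2 (cellMeasure m) := by
      rw [memLp_two_iff_integrable_sq_norm hφ.aestronglyMeasurable]
      simpa only [hn] using hz₁
    have h2 := parseval_cell μ hφ hφL
    have h3 : ∀ z₂, ‖p z₂ * g (z₁, z₂)‖ₑ = ‖g (z₁, z₂)‖ₑ := fun z₂ => by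
      rw [← ofReal_norm, ← ofReal_norm, hn]
    simp_rw [h3] at h2
    refine Eq.trans ?_ h2
    rw [← tsum_subtype_eq_of_support_subset (s := {n | matchesBits n μ})]
    · refine tsum_congr fun n => ?_
      have : matchesBits n.1 μ := n.2
      simp only [F, this, if_true, p, sssKet_eq, mul_assoc]
    · intro n hn
      by_contra h
      exact hn (if_neg h)
  · intro n
    simp only [F]
    split_ifs with h
    · have hk : Measurable fun p : (Fin m → ℝ) × (Fin m → ℝ) => sssKet n p.1 p.2 := by
        unfold sssKet; fun_prop
      exact ((hk.stronglyMeasurable.mul hg).integral_prod_right').enorm.pow_const 2 |>.aemeasurable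
    · exact aemeasurable_const

/-! ### The logical sectors as orthogonal isometric copies of the syndrome space, and the square
projections. -/

lemma coeFn_sssIncl {m : ℕ} (μ : Bits m) (g : Syndrome m) : sssIncl μ g =ᵐ[volume] sssFun μ g :=
  (memLp_sssFun μ g).coeFn_toLp

lemma norm_sssIncl {m : ℕ} (μ : Bits m) (g : Syndrome m) : ‖sssIncl μ g‖ = ‖g‖ := by
  rw [Lp.norm_def, Lp.norm_def, eLpNorm_congr_ae (coeFn_sssIncl μ g),
    eLpNorm_sssFun μ (Lp.stronglyMeasurable g) (Lp.memLp g)]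

lemma inner_sssIncl {m : ℕ} (μ : Bits m) (g g' : Syndrome m) :
    ⟪sssIncl μ g, sssIncl μ g'⟫_ℂ = ⟪g, g'⟫_ℂ :=
  LinearIsometry.inner_map_map ⟨(sssIncl μ).toLinearMap, norm_sssIncl μ⟩ g g'

/-- The supports are disjoint: the lattice index of a position has only one parity. -/
lemma inner_sssIncl_of_ne {m : ℕ} {μ ν : Bits m} (h : μ ≠ ν) (g g' : Syndrome m) :
    ⟪sssIncl μ g, sssIncl ν g'⟫_ℂ = 0 := by
  rw [L2.inner_def]
  refine integral_eq_zero_of_ae ?_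
  filter_upwards [coeFn_sssIncl μ g, coeFn_sssIncl ν g'] with x h1 h2
  rw [h1, h2, sssFun, sssFun]
  split_ifs with hμ hν
  · refine absurd ?_ h
    funext i
    have h1 := hμ i
    have h2 := hν i
    refine Fin.ext ?_
    omega
  all_goals simp

lemma adjoint_sssIncl_apply {m : ℕ} (μ : Bits m) (g : Syndrome m) :
    ContinuousLinearMap.adjoint (sssIncl μ) (sssIncl μ g) = g :=
  ext_inner_left ℂ fun f => by rw [ContinuousLinearMap.adjoint_inner_right, inner_sssIncl]

lemma adjoint_sssIncl_apply_of_ne {m : ℕ} {μ ν : Bits m} (h : μ ≠ ν) (g : Syndrome m) :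
    ContinuousLinearMap.adjoint (sssIncl μ) (sssIncl ν g) = 0 :=
  ext_inner_left ℂ fun f => by
    rw [ContinuousLinearMap.adjoint_inner_right, inner_sssIncl_of_ne h, inner_zero_right]

lemma adjoint_sssIncl_sssIncl {m : ℕ} (μ ν : Bits m) (g : Syndrome m) :
    ContinuousLinearMap.adjoint (sssIncl μ) (sssIncl ν g) = if μ = ν then g else 0 := by
  split_ifs with h
  · rw [h, adjoint_sssIncl_apply]
  · exact adjoint_sssIncl_apply_of_ne h g

lemma coeFn_mulOp {α : Type*} [MeasurableSpace α] (μ : Measure α) (f : α → ℂ) (hf : MemLp f ∞ μ)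
    (g : Lp ℂ 2 μ) : mulOp μ f hf g =ᵐ[μ] fun x => f x * g x := by
  have h := ContinuousLinearMap.coeFn_holder (r := 2) (B := ContinuousLinearMap.mul ℂ ℂ) (hf.toLp f) g
  refine Filter.EventuallyEq.trans (show _ =ᵐ[μ] _ from h) ?_
  filter_upwards [hf.coeFn_toLp] with x hx
  rw [hx]; rfl

/-- The projection onto the functions on the cell supported in `square r`. -/
abbrev squareProj {m : ℕ} (r : Fin m → ℝ) : Syndrome m →L[ℂ] Syndrome m :=
  mulOp ((cellMeasure m).prod (cellMeasure m)) ((square r).indicator 1) (memLp_square r)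

lemma coeFn_squareProj {m : ℕ} (r : Fin m → ℝ) (g : Syndrome m) :
    squareProj r g =ᵐ[(cellMeasure m).prod (cellMeasure m)] (square r).indicator g := by
  filter_upwards [coeFn_mulOp _ _ (memLp_square r) g] with z hz
  rw [hz]
  by_cases h : z ∈ square r <;> simp [h]

lemma squareProj_squareProj {m : ℕ} (r : Fin m → ℝ) (g : Syndrome m) :
    squareProj r (squareProj r g) = squareProj r g := by
  refine Lp.ext ?_
  filter_upwards [coeFn_squareProj r (squareProj r g), coeFn_squareProj r g] with z h1 h2
  rw [h1]
  by_cases h : z ∈ square r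
  · rw [Set.indicator_of_mem h]
  · rw [Set.indicator_of_notMem h, h2, Set.indicator_of_notMem h]

lemma squareProj_eq_self {m : ℕ} {r : Fin m → ℝ} {g : Syndrome m}
    (h : ∀ᵐ z ∂((cellMeasure m).prod (cellMeasure m)), z ∉ square r → g z = 0) :
    squareProj r g = g := by
  refine Lp.ext ?_
  filter_upwards [coeFn_squareProj r g, h] with z h1 h2
  rw [h1]
  by_cases h : z ∈ square r
  · rw [Set.indicator_of_mem h]
  · rw [Set.indicator_of_notMem h, h2 h]

/-- A change of representative on a null set is harmless because rounding to the cell pulls null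
sets back to null sets. -/
lemma coeFn_sssIncl_of_ae_eq {m : ℕ} (μ : Bits m) {g : Syndrome m}
    {f : (Fin m → ℝ) × (Fin m → ℝ) → ℂ} (h : g =ᵐ[(cellMeasure m).prod (cellMeasure m)] f) :
    sssIncl μ g =ᵐ[volume] sssFun μ f := by
  filter_upwards [coeFn_sssIncl μ g, ae_residual h] with x hx h1
  rw [hx]
  simp only [sssFun]
  split_ifs
  · refine integral_congr_ae ?_
    filter_upwards [h1] with z hz
    rw [hz]
  · rfl

/-! ### Operators that permute generalized states up to phases: displacements, X, Z and SUM. -/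

lemma residual_add_latticeIndex {m : ℕ} (x : Fin m → ℝ) :
    (fun i => residual x i + c * (latticeIndex x i : ℝ)) = x := by
  funext i; simp [residual]

lemma latticeIndex_add {m : ℕ} {z : Fin m → ℝ} (hz : z ∈ cell m) (n : Fin m → ℤ) :
    latticeIndex (fun i => z i + c * (n i : ℝ)) = n := by
  rw [latticeIndex_eq_iff]
  convert hz using 1
  funext i; simp

lemma residual_add {m : ℕ} {z : Fin m → ℝ} (hz : z ∈ cell m) (n : Fin m → ℤ) :
    residual (fun i => z i + c * (n i : ℝ)) = z := by
  funext i
  rw [residual, latticeIndex_add hz]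
  simp

lemma mem_cell_of_abs_lt {m : ℕ} {z r : Fin m → ℝ} (hr : ∀ i, r i ≤ c / 2)
    (hz : ∀ i, |z i| < r i) : z ∈ cell m := fun i _ =>
  ⟨by linarith [(abs_lt.mp (hz i)).1, hr i], by linarith [(abs_lt.mp (hz i)).2, hr i]⟩

/-- If `A` acts as `ψ ↦ χ (ψ ∘ τ)`, where `τ` respects the splitting of positions into lattice
points and remainders and maps generalized states to generalized states, without wrapping around
the cell, then `A` acts on the states supported in a square as a logical operator that is
monomial in the computational basis, tensored with an operator on the syndromes. -/
lemma exists_sssIncl_of_monomial {m : ℕ} {r R : Fin m → ℝ} {A : Mode m →L[ℂ] Mode m}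
    {χ : (Fin m → ℝ) → ℂ} {τ σ₁ σ₂ : (Fin m → ℝ) → (Fin m → ℝ)} {l : (Fin m → ℤ) → (Fin m → ℤ)}
    {p : (Fin m → ℝ) × (Fin m → ℝ) → ℂ} {π : Bits m → Bits m} {L : Bits m → ℂ}
    (hA : ∀ ψ, A ψ =ᵐ[volume] fun x => χ x * ψ (τ x)) (hτ : MeasurePreserving τ)
    (hτi : Function.Injective τ) (hσ₁ : MeasurePreserving σ₁) (hσ₁s : Function.Surjective σ₁)
    (hσ₂ : MeasurePreserving σ₂) (hl : Function.Surjective l)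
    (hcov : ∀ (n : Fin m → ℤ) (z : Fin m → ℝ),
      τ (fun i => z i + c * n i) = fun i => σ₁ z i + c * l n i)
    (hr : ∀ i, r i ≤ c / 2) (hR : ∀ i, R i ≤ c / 2)
    (h₁ : ∀ z, (∀ i, |σ₁ z i| < r i) → ∀ i, |z i| < R i)
    (h₂ : ∀ z, (∀ i, |σ₂ z i| < r i) → ∀ i, |z i| < R i)
    (hp : Continuous p) (hpn : ∀ z, ‖p z‖ = 1)
    (hm : ∀ n μ, matchesBits (l n) μ ↔ matchesBits n (π μ))
    (hket : ∀ μ n z₁ z₂, matchesBits (l n) μ →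
      χ (fun i => z₁ i + c * n i) * sssKet (l n) (σ₁ z₁) (σ₂ z₂) =
        L μ * (sssKet n z₁ z₂ * p (z₁, z₂)))
    (g : Syndrome m) :
    ∃ h : Syndrome m, squareProj R h = h ∧
      ∀ μ, A (sssIncl μ (squareProj r g)) = L μ • sssIncl (π μ) h := by
  let g₀ : (Fin m → ℝ) × (Fin m → ℝ) → ℂ := (square r).indicator g
  have hg₀ : ∀ z, z ∉ square r → g₀ z = 0 := fun z hz => Set.indicator_of_notMem hz _
  have hg₀m : StronglyMeasurable g₀ :=
    (Lp.stronglyMeasurable g).indicator (measurableSet_square r)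
  -- The new syndrome state: transported by `σ₁` and `σ₂`, with the phase that is common to all `n`
  -- and `μ`.
  let h₀ : (Fin m → ℝ) × (Fin m → ℝ) → ℂ := fun z => p z * g₀ (σ₁ z.1, σ₂ z.2)
  have hsub : square r ⊆ cell m ×ˢ cell m := fun z hz =>
    ⟨mem_cell_of_abs_lt hr fun i => (hz i).1, mem_cell_of_abs_lt hr fun i => (hz i).2⟩
  -- The maps `σ₁`, `σ₂` preserve Lebesgue measure on the whole space but not the cell, so
  -- integrability is first moved to the whole space; the square lies inside the cell.
  have hg₀L : MemLp g₀ 2 (volume.prod volume) := by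
    have h0 : ∀ f : (Fin m → ℝ) × (Fin m → ℝ) → ℂ, Function.support f ⊆ cell m ×ˢ cell m →
        MemLp f 2 ((cellMeasure m).prod (cellMeasure m)) → MemLp f 2 (volume.prod volume) :=
      fun f hf hL => by
        rw [Measure.prod_restrict, ← memLp_indicator_iff_restrict
          ((measurableSet_cell m).prod (measurableSet_cell m)), Set.indicator_eq_self.mpr hf] at hL
        exact hL
    exact h0 _ (Set.support_indicator_subset.trans hsub)
      ((Lp.memLp g).indicator (measurableSet_square r))
  have hh₀L : MemLp h₀ 2 ((cellMeasure m).prod (cellMeasure m)) := by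
    have h1 : MemLp (fun z : (Fin m → ℝ) × (Fin m → ℝ) => g₀ (σ₁ z.1, σ₂ z.2)) 2
        (volume.prod volume) := hg₀L.comp_measurePreserving (hσ₁.prod hσ₂)
    have h2 : MemLp h₀ 2 (volume.prod volume) :=
      h1.of_le (hp.aestronglyMeasurable.mul h1.1) (Filter.Eventually.of_forall fun z => by
        simp only [h₀, norm_mul, hpn, one_mul, le_refl])
    rw [Measure.prod_restrict]
    exact h2.restrict _
  refine ⟨hh₀L.toLp h₀, squareProj_eq_self ?_, fun μ => ?_⟩
  · filter_upwards [hh₀L.coeFn_toLp] with z hz hzR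
    rw [hz]
    simp only [h₀]
    rw [hg₀, mul_zero]
    exact fun h => hzR fun i => ⟨h₁ z.1 (fun i => (h i).1) i, h₂ z.2 (fun i => (h i).2) i⟩
  refine Lp.ext ?_
  filter_upwards [hA (sssIncl μ (squareProj r g)),
    hτ.quasiMeasurePreserving.ae (coeFn_sssIncl_of_ae_eq μ (coeFn_squareProj r g)),
    Lp.coeFn_smul (L μ) (sssIncl (π μ) (hh₀L.toLp h₀)),
    coeFn_sssIncl_of_ae_eq (π μ) hh₀L.coeFn_toLp] with x e1 e2 e3 e4
  rw [e1, e2, e3, Pi.smul_apply, e4, smul_eq_mul]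
  clear e1 e2 e3 e4
  change χ x * sssFun μ g₀ (τ x) = _
  -- For the same reason the `z₂` integrals are extended to the whole space before substituting
  -- `σ₂`.
  have hfull : ∀ F : (Fin m → ℝ) → ℂ, (∀ z, z ∉ cell m → F z = 0) →
      ∫ z, F z ∂(cellMeasure m) = ∫ z, F z := fun F hF =>
    setIntegral_eq_integral_of_forall_compl_eq_zero hF
  set n := latticeIndex x with hn
  set z₁ := residual x with hz₁
  have hx : (fun i => z₁ i + c * (n i : ℝ)) = x := residual_add_latticeIndex x
  -- Inside the square rounding commutes with `τ`; outside it both sides vanish.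
  by_cases hz : ∀ i, |σ₁ z₁ i| < r i
  · have hτx : τ x = fun i => σ₁ z₁ i + c * (l n i : ℝ) := by rw [← hcov, hx]
    have hlat : latticeIndex (τ x) = l n := by
      rw [hτx, latticeIndex_add (mem_cell_of_abs_lt hr hz)]
    have hres : residual (τ x) = σ₁ z₁ := by
      rw [hτx, residual_add (mem_cell_of_abs_lt hr hz)]
    by_cases hmat : matchesBits (l n) μ
    swap
    · rw [sssFun, sssFun, hlat, if_neg hmat, ← hn, if_neg fun h => hmat ((hm n μ).mpr h), mul_zero,
        mul_zero]
    rw [sssFun, sssFun, hlat, hres, if_pos hmat, ← hn, if_pos ((hm n μ).mp hmat), hfull, hfull,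
      ← integral_const_mul, ← integral_const_mul]
    · let F : (Fin m → ℝ) → ℂ := fun z => χ x * (sssKet (l n) (σ₁ z₁) z * g₀ (σ₁ z₁, z))
      have hF : StronglyMeasurable F := by
        refine stronglyMeasurable_const.mul (StronglyMeasurable.mul ?_
          (hg₀m.comp_measurable measurable_prodMk_left))
        refine Continuous.stronglyMeasurable ?_
        unfold sssKet
        fun_prop
      have h3 := integral_map hσ₂.aemeasurable (f := F) hF.aestronglyMeasurable
      rw [hσ₂.map_eq] at h3
      refine h3.trans (integral_congr_ae (Filter.Eventually.of_forall fun z => ?_))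
      have h4 := hket μ n z₁ z hmat
      rw [hx] at h4
      simp only [F, h₀, ← hz₁]
      rw [← mul_assoc, h4]
      ring
    · intro z hzc
      simp only [h₀]
      rw [hg₀, mul_zero, mul_zero]
      exact fun h => hzc (mem_cell_of_abs_lt hR (h₂ z fun i => (h i).2))
    · intro z hzc
      rw [hg₀, mul_zero]
      exact fun h => hzc (mem_cell_of_abs_lt hr fun i => (h i).2)
  · have hR0 : sssFun (π μ) h₀ x = 0 := by
      simp only [sssFun, ← hn, ← hz₁, h₀]
      split_ifs
      · refine integral_eq_zero_of_ae (Filter.Eventually.of_forall fun z => ?_)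
        simp only [Pi.zero_apply]
        rw [hg₀, mul_zero, mul_zero]
        exact fun h => hz fun i => (h i).1
      · rfl
    -- No wrap-around: if `τ x` had its remainder in the square, lifting its lattice index and
    -- remainder through `l` and `σ₁` would give a position with the same image as `x`. That
    -- position is `x`, and its lifted remainder lies in the cell, so it is `z₁`, against `hz`.
    have hres : ¬ ∀ i, |residual (τ x) i| < r i := by
      intro h
      obtain ⟨n', hn'⟩ := hl (latticeIndex (τ x))
      obtain ⟨z', hz'⟩ := hσ₁s (residual (τ x))
      have hx' : (fun i => z' i + c * (n' i : ℝ)) = x := by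
        apply hτi
        rw [hcov, hn', hz', residual_add_latticeIndex]
      rw [← hz'] at h
      have hz'c : z' ∈ cell m := mem_cell_of_abs_lt hR (h₁ z' h)
      have : z₁ = z' := by rw [hz₁, ← hx', residual_add hz'c]
      exact hz (this ▸ h)
    have hL0 : sssFun μ g₀ (τ x) = 0 := by
      simp only [sssFun]
      split_ifs
      · refine integral_eq_zero_of_ae (Filter.Eventually.of_forall fun z => ?_)
        simp only [Pi.zero_apply]
        rw [hg₀, mul_zero]
        exact fun h => hres fun i => (h i).1
      · rfl
    rw [hR0, hL0, mul_zero, mul_zero]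

lemma coeFn_displacement {m : ℕ} (v₁ v₂ : Fin m → ℝ) (ψ : Mode m) :
    displacement v₁ v₂ ψ =ᵐ[volume] fun x =>
      Complex.exp (Complex.I * ((∑ i, (v₂ i * x i - v₁ i * v₂ i / 2) : ℝ) : ℂ)) * ψ (x - v₁) := by
  have hmp : MeasurePreserving (fun x : Fin m → ℝ => x - v₁) :=
    measurePreserving_sub_right volume v₁
  filter_upwards [coeFn_mulOp volume _ (memLp_phase v₁ v₂) (Lp.compMeasurePreservingₗᵢ ℂ
    (fun x : Fin m → ℝ => x - v₁) hmp ψ), Lp.coeFn_compMeasurePreserving ψ hmp] with x h1 h2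
  refine Eq.trans h1 ?_
  congr 1

lemma coeFn_sumGate (ψ : Mode 2) :
    sumGate ψ =ᵐ[volume] fun x => ψ ![x 0, x 1 - x 0] :=
  Lp.coeFn_compMeasurePreserving ψ shear_preserving

/-- A small displacement acts on the states supported in a square as an operator on the syndromes
that does not depend on the logical state. -/
lemma exists_displacement_sssIncl {m : ℕ} {r R : Fin m → ℝ} {s : ℝ} (hs : 0 ≤ s)
    (hrR : ∀ i, r i + s ≤ R i) (hR : ∀ i, R i ≤ c / 2) {v₁ v₂ : Fin m → ℝ}
    (hv : ∀ i, |v₁ i| ≤ s ∧ |v₂ i| ≤ s) (g : Syndrome m) :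
    ∃ h : Syndrome m, squareProj R h = h ∧
      ∀ μ, displacement v₁ v₂ (sssIncl μ (squareProj r g)) = sssIncl μ h := by
  obtain ⟨h, h1, h2⟩ := exists_sssIncl_of_monomial (r := r) (R := R) (A := displacement v₁ v₂)
    (χ := fun x => Complex.exp (Complex.I * ((∑ i, (v₂ i * x i - v₁ i * v₂ i / 2) : ℝ) : ℂ)))
    (τ := fun x => x - v₁) (σ₁ := fun x => x - v₁) (σ₂ := fun x => x - v₂) (l := id)
    -- The term `v₂ · c n` of the displacement phase cancels against the shift of `z₂` in the ket.
    -- What remains is the symplectic phase, free of `n` and thus of the logical state.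
    (p := fun z => Complex.exp (Complex.I * ((∑ i, (v₂ i * z.1 i - v₁ i * z.2 i) / 2 : ℝ) : ℂ)))
    (π := id) (L := fun _ => 1) (coeFn_displacement v₁ v₂)
    (measurePreserving_sub_right volume v₁) (sub_left_injective)
    (measurePreserving_sub_right volume v₁) (fun y => ⟨y + v₁, by simp⟩)
    (measurePreserving_sub_right volume v₂) Function.surjective_id
    (fun n z => by funext i; simp only [Pi.sub_apply, id]; ring)
    (fun i => by linarith [hrR i, hR i]) hR
    (fun z hz i => by
      have h1 := abs_lt.mp (hz i)
      have h2 := abs_le.mp (hv i).1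
      rw [Pi.sub_apply] at h1
      exact abs_lt.mpr ⟨by linarith [hrR i], by linarith [hrR i]⟩)
    (fun z hz i => by
      have h1 := abs_lt.mp (hz i)
      have h2 := abs_le.mp (hv i).2
      rw [Pi.sub_apply] at h1
      exact abs_lt.mpr ⟨by linarith [hrR i], by linarith [hrR i]⟩)
    (by fun_prop) (fun z => by rw [mul_comm, Complex.norm_exp_ofReal_mul_I])
    (fun n μ => Iff.rfl)
    (fun μ n z₁ z₂ _ => by
      simp only [sssKet, one_mul, id]
      rw [mul_left_comm, mul_assoc, ← Complex.exp_add, ← Complex.exp_add, ← mul_add, ← mul_add,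
        ← Complex.ofReal_add, ← Complex.ofReal_add, ← Finset.sum_add_distrib,
        ← Finset.sum_add_distrib]
      congr 5
      funext i
      simp only [Pi.sub_apply]
      ring) g
  exact ⟨h, h1, fun μ => by rw [h2, one_smul]; rfl⟩

/-- A shift by one lattice site flips the parity and keeps the remainder; the change of site costs
only the phase `exp(-i c z₂)`, which acts on the syndrome. -/
lemma exists_X_sssIncl {r : Fin 1 → ℝ} (hr : ∀ i, r i ≤ c / 2) (g : Syndrome 1) :
    ∃ h : Syndrome 1, squareProj r h = h ∧ ∀ μ, Gate.X.physical (sssIncl μ (squareProj r g)) =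
      ∑ ν, Gate.X.logical ν μ • sssIncl ν h := by
  obtain ⟨h, h1, h2⟩ := exists_sssIncl_of_monomial (r := r) (R := r) (A := Gate.X.physical)
    (χ := fun x => 1) (τ := fun x => x - fun _ => c) (σ₁ := id) (σ₂ := id) (l := fun n i => n i - 1)
    (p := fun z => Complex.exp (Complex.I * ((∑ i, -(c * z.2 i) : ℝ) : ℂ)))
    (π := fun μ i => μ i + 1) (L := fun _ => 1)
    (fun ψ => by
      filter_upwards [coeFn_displacement (fun _ => c) (fun _ => 0) ψ] with x hx
      refine Eq.trans hx ?_
      simp)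
    (measurePreserving_sub_right volume _) sub_left_injective (MeasurePreserving.id _)
    Function.surjective_id (MeasurePreserving.id _) (fun n => ⟨fun i => n i + 1, by simp⟩)
    (fun n z => by funext i; simp only [Pi.sub_apply, id]; push_cast; ring)
    hr hr (fun z hz => hz) (fun z hz => hz) (by fun_prop)
    (fun z => by rw [mul_comm, Complex.norm_exp_ofReal_mul_I])
    (fun n μ => forall_congr' fun i => by
      dsimp only
      generalize μ i = b
      fin_cases b <;> simp <;> omega)
    (fun μ n z₁ z₂ _ => by
      simp only [sssKet, one_mul, id]
      rw [mul_assoc, ← Complex.exp_add, ← mul_add, ← Complex.ofReal_add, ← Finset.sum_add_distrib]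
      congr 5
      funext i
      push_cast
      ring) g
  refine ⟨h, h1, fun μ => ?_⟩
  rw [h2, one_smul, Finset.sum_eq_single_of_mem (fun i => μ i + 1) (Finset.mem_univ _)]
  · have : Gate.X.logical (fun i => μ i + 1) μ = 1 := by
      simp only [Gate.logical, oneQubit, Matrix.of_apply]
      generalize μ 0 = b
      fin_cases b <;> simp
    rw [this, one_smul]
  · intro ν _ hν
    have : Gate.X.logical ν μ = 0 := by
      have h3 : ν 0 ≠ μ 0 + 1 := fun h => hν (by funext i; rw [Subsingleton.elim i 0, h])
      simp only [Gate.logical, oneQubit, Matrix.of_apply]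
      generalize μ 0 = b at *
      generalize ν 0 = a at *
      fin_cases b <;> fin_cases a <;> simp_all
    rw [this, zero_smul]

/-- At `x = z₁ + c n` the phase `exp(i c x)` splits into `exp(i c z₁)`, a syndrome operator, and
`exp(i π n)`, the sign of the parity. -/
lemma exists_Z_sssIncl {r : Fin 1 → ℝ} (hr : ∀ i, r i ≤ c / 2) (g : Syndrome 1) :
    ∃ h : Syndrome 1, squareProj r h = h ∧ ∀ μ, Gate.Z.physical (sssIncl μ (squareProj r g)) =
      ∑ ν, Gate.Z.logical ν μ • sssIncl ν h := by
  obtain ⟨h, h1, h2⟩ := exists_sssIncl_of_monomial (r := r) (R := r) (A := Gate.Z.physical)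
    (χ := fun x => Complex.exp (Complex.I * ((c * x 0 : ℝ) : ℂ)))
    (τ := id) (σ₁ := id) (σ₂ := id) (l := id)
    (p := fun z => Complex.exp (Complex.I * ((c * z.1 0 : ℝ) : ℂ)))
    (π := id) (L := fun μ => (-1) ^ (μ 0 : ℕ))
    (fun ψ => by
      filter_upwards [coeFn_displacement (fun _ => 0) (fun _ => c) ψ] with x hx
      refine Eq.trans hx ?_
      have : x - (fun _ => 0) = x := by funext i; simp
      rw [this]
      simp)
    (MeasurePreserving.id _) Function.injective_id (MeasurePreserving.id _)
    Function.surjective_id (MeasurePreserving.id _) Function.surjective_id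
    (fun n z => rfl)
    hr hr (fun z hz => hz) (fun z hz => hz) (by fun_prop)
    (fun z => by rw [mul_comm, Complex.norm_exp_ofReal_mul_I])
    (fun n μ => Iff.rfl)
    (fun μ n z₁ z₂ hn => by
      obtain ⟨k, hk⟩ : ∃ k : ℤ, n 0 = ((μ 0 : ℕ) : ℤ) + k * 2 := ⟨n 0 / 2, by
        have := hn 0
        simp only [id] at this
        omega⟩
      have h1 : Complex.exp (Complex.I * ((c * (z₁ 0 + c * (n 0 : ℝ)) : ℝ) : ℂ)) =
          (-1) ^ (μ 0 : ℕ) * Complex.exp (Complex.I * ((c * z₁ 0 : ℝ) : ℂ)) := by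
        have h2 : Complex.I * ((c * (z₁ 0 + c * (n 0 : ℝ)) : ℝ) : ℂ) =
            ((μ 0 : ℕ) : ℂ) * (Real.pi * Complex.I) + k * (2 * Real.pi * Complex.I) +
              Complex.I * ((c * z₁ 0 : ℝ) : ℂ) := by
          rw [mul_add, ← mul_assoc, c_sq, hk]; push_cast; ring
        rw [h2, Complex.exp_add, Complex.exp_add, Complex.exp_int_mul_two_pi_mul_I, mul_one,
          Complex.exp_nat_mul, Complex.exp_pi_mul_I]
      rw [h1]
      simp only [id]
      ring) g
  refine ⟨h, h1, fun μ => ?_⟩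
  rw [h2, Finset.sum_eq_single_of_mem μ (Finset.mem_univ _)]
  · have : Gate.Z.logical μ μ = (-1) ^ (μ 0 : ℕ) := by
      simp only [Gate.logical, oneQubit, Matrix.of_apply]
      generalize μ 0 = b
      fin_cases b <;> simp
    rw [this]; rfl
  · intro ν _ hν
    have : Gate.Z.logical ν μ = 0 := by
      have h3 : ν 0 ≠ μ 0 := fun h => hν (by funext i; rw [Subsingleton.elim i 0, h])
      simp only [Gate.logical, oneQubit, Matrix.of_apply]
      generalize μ 0 = b at *
      generalize ν 0 = a at *
      fin_cases b <;> fin_cases a <;> simp_all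
    rw [this, zero_smul]

lemma exists_I_sssIncl {r : Fin 1 → ℝ} (g : Syndrome 1) :
    ∃ h : Syndrome 1, squareProj r h = h ∧ ∀ μ, Gate.I.physical (sssIncl μ (squareProj r g)) =
      ∑ ν, Gate.I.logical ν μ • sssIncl ν h :=
  ⟨squareProj r g, squareProj_squareProj r g, fun μ => by
    simp [Gate.physical, Gate.logical, Matrix.one_apply]⟩

lemma shear_transpose_preserving :
    MeasurePreserving (fun x : Fin 2 → ℝ => ![x 0 + x 1, x 1]) := by
  have h := Real.volume_preserving_transvectionStruct
    (⟨0, 1, by decide, 1⟩ : Matrix.TransvectionStruct (Fin 2) ℝ)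
  convert h using 1
  funext x i
  fin_cases i <;> simp [Matrix.TransvectionStruct.toMatrix, Matrix.transvection,
    Matrix.toLin'_apply, Matrix.single]

/-- The position shear acts on the remainders `z₁` and on the lattice indices. The quasi-momenta
`z₂` transform by the contragredient shear, which leaves the ket unchanged with no phase. Each shear
adds an error of one mode to the other, so both radii become the sum. -/
lemma exists_CNOT_sssIncl {r R : Fin 2 → ℝ} (hr : ∀ i, 0 ≤ r i) (hR : ∀ i, R i = r 0 + r 1)
    (hRc : r 0 + r 1 ≤ c / 2) (g : Syndrome 2) :
    ∃ h : Syndrome 2, squareProj R h = h ∧ ∀ μ, Gate.CNOT.physical (sssIncl μ (squareProj r g)) =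
      ∑ ν, Gate.CNOT.logical ν μ • sssIncl ν h := by
  have hr0 := hr 0
  have hr1 := hr 1
  obtain ⟨h, h1, h2⟩ := exists_sssIncl_of_monomial (r := r) (R := R) (A := Gate.CNOT.physical)
    (χ := fun _ => 1) (τ := fun x => ![x 0, x 1 - x 0]) (σ₁ := fun x => ![x 0, x 1 - x 0])
    (σ₂ := fun x => ![x 0 + x 1, x 1]) (l := fun n => ![n 0, n 1 - n 0])
    (p := fun _ => 1) (π := fun μ => ![μ 0, μ 0 + μ 1]) (L := fun _ => 1)
    (fun ψ => by
      filter_upwards [coeFn_sumGate ψ] with x hx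
      rw [one_mul]
      exact hx)
    shear_preserving
    (fun x y hxy => by
      have h0 := congrFun hxy 0
      have h1 := congrFun hxy 1
      simp only [Matrix.cons_val_zero, Matrix.cons_val_one] at h0 h1
      funext i
      fin_cases i
      · exact h0
      · change x 1 = y 1
        linarith)
    shear_preserving
    (fun y => ⟨![y 0, y 1 + y 0], by funext i; fin_cases i <;> simp⟩)
    shear_transpose_preserving
    (fun y => ⟨![y 0, y 1 + y 0], by funext i; fin_cases i <;> simp⟩)
    (fun n z => by
      funext i
      fin_cases i
      · simp
      · simp; ring)
    (fun i => by fin_cases i <;> simp <;> linarith)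
    (fun i => by rw [hR]; exact hRc)
    (fun z hz i => by
      rw [hR]
      have h0 := abs_lt.mp (hz 0)
      have h1 := abs_lt.mp (hz 1)
      simp only [Matrix.cons_val_zero, Matrix.cons_val_one] at h0 h1
      refine abs_lt.mpr ?_
      fin_cases i <;> dsimp only [Fin.zero_eta, Fin.mk_one] <;> constructor <;> linarith)
    (fun z hz i => by
      rw [hR]
      have h0 := abs_lt.mp (hz 0)
      have h1 := abs_lt.mp (hz 1)
      simp only [Matrix.cons_val_zero, Matrix.cons_val_one] at h0 h1
      refine abs_lt.mpr ?_
      fin_cases i <;> dsimp only [Fin.zero_eta, Fin.mk_one] <;> constructor <;> linarith)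
    continuous_const (fun z => by simp)
    (fun n μ => by
      simp only [matchesBits, Fin.forall_fin_two, Matrix.cons_val_zero, Matrix.cons_val_one]
      generalize μ 0 = a
      generalize μ 1 = b
      fin_cases a <;> fin_cases b <;> simp <;> omega)
    (fun μ n z₁ z₂ _ => by
      simp only [sssKet, one_mul, mul_one, Fin.sum_univ_two, Matrix.cons_val_zero,
        Matrix.cons_val_one]
      congr 4
      push_cast
      ring) g
  refine ⟨h, h1, fun μ => ?_⟩
  rw [h2, one_smul, Finset.sum_eq_single_of_mem ![μ 0, μ 0 + μ 1] (Finset.mem_univ _)]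
  · simp [Gate.logical]
  · intro ν _ hν
    have : Gate.CNOT.logical ν μ = 0 := by
      simp only [Gate.logical, Matrix.of_apply]
      refine if_neg fun h => hν ?_
      funext i
      fin_cases i
      · exact h.1
      · exact h.2
    rw [this, zero_smul]

/-! ### Hermite functions as eigenfunctions of the Fourier integral. -/

/-- The Fourier integral of a polynomial times the Gaussian `exp(-y² / 2)`. -/
def gaussFourier (x : ℝ) (p : Polynomial ℝ) : ℂ :=
  ∫ y : ℝ, Complex.exp (Complex.I * ((x * y : ℝ) : ℂ)) *
    ((p.eval y * Real.exp (-(1 / 2) * y ^ 2) : ℝ) : ℂ)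

lemma integrable_gaussFourier (x : ℝ) (p : Polynomial ℝ) :
    Integrable fun y : ℝ => Complex.exp (Complex.I * ((x * y : ℝ) : ℂ)) *
      ((p.eval y * Real.exp (-(1 / 2) * y ^ 2) : ℝ) : ℂ) := by
  refine (integrable_poly_gauss p (by norm_num : (0 : ℝ) < 1 / 2)).ofReal.bdd_mul (c := 1)
    (Continuous.aestronglyMeasurable (by fun_prop)) (Filter.Eventually.of_forall fun y => ?_)
  rw [mul_comm, Complex.norm_exp_ofReal_mul_I]

lemma gaussFourier_add (x : ℝ) (p q : Polynomial ℝ) :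
    gaussFourier x (p + q) = gaussFourier x p + gaussFourier x q := by
  rw [gaussFourier, gaussFourier, gaussFourier,
    ← integral_add (integrable_gaussFourier x p) (integrable_gaussFourier x q)]
  refine integral_congr_ae (Filter.Eventually.of_forall fun y => ?_)
  simp only [Polynomial.eval_add]; push_cast; ring

lemma gaussFourier_C_mul (x a : ℝ) (p : Polynomial ℝ) :
    gaussFourier x (Polynomial.C a * p) = a * gaussFourier x p := by
  rw [gaussFourier, gaussFourier, ← integral_const_mul]
  refine integral_congr_ae (Filter.Eventually.of_forall fun y => ?_)
  simp only [Polynomial.eval_mul, Polynomial.eval_C]; push_cast; ring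

lemma gaussFourier_one (x : ℝ) :
    gaussFourier x 1 = Real.sqrt (2 * Real.pi) * Real.exp (-(1 / 2) * x ^ 2) := by
  have h := fourierIntegral_gaussian (b := 1 / 2) (by norm_num) (x : ℂ)
  have h1 : ∀ y : ℝ, Complex.exp (Complex.I * ((x * y : ℝ) : ℂ)) *
      (((1 : Polynomial ℝ).eval y * Real.exp (-(1 / 2) * y ^ 2) : ℝ) : ℂ) =
      Complex.exp (Complex.I * x * y) * Complex.exp (-(1 / 2) * (y : ℂ) ^ 2) := fun y => by
    rw [Polynomial.eval_one, one_mul]; push_cast; rw [mul_assoc]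
  rw [gaussFourier]
  simp_rw [h1]
  rw [h]
  congr 1
  · rw [Real.sqrt_eq_rpow, Complex.ofReal_cpow (by positivity)]
    congr 1
    · push_cast; ring
    · push_cast; ring
  · push_cast; congr 1; ring

/-- Integration by parts: the integral of the derivative of `exp(i x y) p(y) exp(-y² / 2)` vanishes.
-/
lemma gaussFourier_X_mul (x : ℝ) (p : Polynomial ℝ) :
    gaussFourier x (Polynomial.X * p) =
      Complex.I * x * gaussFourier x p + gaussFourier x (Polynomial.derivative p) := by
  have hd : ∀ y : ℝ, HasDerivAt (fun y : ℝ => Complex.exp (Complex.I * ((x * y : ℝ) : ℂ)) *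
      ((p.eval y * Real.exp (-(1 / 2) * y ^ 2) : ℝ) : ℂ))
      (Complex.I * x * (Complex.exp (Complex.I * ((x * y : ℝ) : ℂ)) *
        ((p.eval y * Real.exp (-(1 / 2) * y ^ 2) : ℝ) : ℂ)) +
       (Complex.exp (Complex.I * ((x * y : ℝ) : ℂ)) *
        (((Polynomial.derivative p).eval y * Real.exp (-(1 / 2) * y ^ 2) : ℝ) : ℂ) -
       Complex.exp (Complex.I * ((x * y : ℝ) : ℂ)) *
        (((Polynomial.X * p).eval y * Real.exp (-(1 / 2) * y ^ 2) : ℝ) : ℂ))) y := by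
    intro y
    have h1 : HasDerivAt (fun y : ℝ => Complex.exp (Complex.I * ((x * y : ℝ) : ℂ)))
        (Complex.exp (Complex.I * ((x * y : ℝ) : ℂ)) * (Complex.I * x)) y := by
      have := (((hasDerivAt_id y).const_mul x).ofReal_comp.const_mul Complex.I).cexp
      simpa using this
    have h2 : HasDerivAt (fun y : ℝ => Real.exp (-(1 / 2) * y ^ 2))
        (Real.exp (-(1 / 2) * y ^ 2) * (-y)) y := by
      have := (((hasDerivAt_id y).pow 2).const_mul (-(1 / 2 : ℝ))).exp
      refine this.congr_deriv ?_
      simp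
    refine (h1.mul ((p.hasDerivAt y).mul h2).ofReal_comp).congr_deriv ?_
    simp only [Polynomial.eval_mul, Polynomial.eval_X, Pi.mul_apply]
    push_cast
    ring
  have i1 := (integrable_gaussFourier x p).const_mul (Complex.I * x)
  have i2 := integrable_gaussFourier x (Polynomial.derivative p)
  have i3 := integrable_gaussFourier x (Polynomial.X * p)
  have := integral_eq_zero_of_hasDerivAt_of_integrable hd (i1.add (i2.sub i3))
    (integrable_gaussFourier x p)
  have hadd := integral_add i1 (i2.sub i3)
  simp only [Pi.sub_apply] at hadd
  rw [hadd, integral_sub i2 i3, integral_const_mul] at this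
  simp only [gaussFourier]
  linear_combination -this

/-- The Hermite polynomial `He_n(√2 y)`. -/
def scaledHermite (n : ℕ) : Polynomial ℝ :=
  ((Polynomial.hermite n).map (Int.castRingHom ℝ)).comp (Polynomial.C (Real.sqrt 2) * Polynomial.X)

lemma derivative_hermite (n : ℕ) : Polynomial.derivative (Polynomial.hermite (n + 1)) =
    (n + 1 : ℤ) • Polynomial.hermite n := by
  induction n with
  | zero => simp
  | succ n ih =>
    have h := Polynomial.hermite_succ n
    rw [Polynomial.hermite_succ (n + 1), Polynomial.derivative_sub, Polynomial.derivative_mul, ih,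
      Polynomial.derivative_smul, Polynomial.derivative_X, one_mul]
    simp only [zsmul_eq_mul]
    push_cast
    linear_combination -((n : Polynomial ℤ) + 1) * h

lemma derivative_scaledHermite (n : ℕ) : Polynomial.derivative (scaledHermite (n + 1)) =
    Polynomial.C (Real.sqrt 2 * (n + 1)) * scaledHermite n := by
  rw [scaledHermite, Polynomial.derivative_comp, Polynomial.derivative_map, derivative_hermite]
  simp only [scaledHermite, Polynomial.derivative_mul, Polynomial.derivative_C, zero_mul,
    Polynomial.derivative_X, mul_one, zero_add, zsmul_eq_mul, Polynomial.map_mul, Polynomial.mul_comp,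
    Polynomial.C_mul]
  simp
  ring

lemma scaledHermite_succ_succ (n : ℕ) : scaledHermite (n + 2) =
    Polynomial.C (Real.sqrt 2) * (Polynomial.X * scaledHermite (n + 1)) +
      Polynomial.C (-((n : ℝ) + 1)) * scaledHermite n := by
  rw [scaledHermite, Polynomial.hermite_succ, derivative_hermite]
  simp only [scaledHermite, zsmul_eq_mul, Polynomial.map_mul, Polynomial.mul_comp,
    Polynomial.map_sub, Polynomial.sub_comp, Polynomial.map_X, Polynomial.X_comp]
  simp
  ring

/-- The three-term recurrence is fed into `gaussFourier_X_mul`. The derivative term contributes `2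
(n + 1)`, turning the coefficient `-(n + 1)` into `n + 1`, which is the sign change that `i ^ (n +
2) = -i ^ n` requires. -/
lemma gaussFourier_scaledHermite (x : ℝ) (n : ℕ) : gaussFourier x (scaledHermite n) =
    Real.sqrt (2 * Real.pi) * Complex.I ^ n *
      (((scaledHermite n).eval x * Real.exp (-(1 / 2) * x ^ 2) : ℝ) : ℂ) := by
  induction n using Nat.twoStepInduction with
  | zero =>
    have : scaledHermite 0 = 1 := by simp [scaledHermite]
    rw [this, gaussFourier_one]
    simp
  | one =>
    have : scaledHermite 1 = Polynomial.C (Real.sqrt 2) * (Polynomial.X * 1) := by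
      simp [scaledHermite]
    rw [this, gaussFourier_C_mul, gaussFourier_X_mul, Polynomial.derivative_one, gaussFourier_one]
    have h0 : gaussFourier x 0 = 0 := by simp [gaussFourier]
    rw [h0]
    simp
    ring
  | more n h0 h1 =>
    have h2 : (Real.sqrt 2 : ℂ) * Real.sqrt 2 = 2 := by
      rw [← Complex.ofReal_mul, Real.mul_self_sqrt (by norm_num)]; norm_num
    rw [scaledHermite_succ_succ, gaussFourier_add, gaussFourier_C_mul, gaussFourier_C_mul,
      gaussFourier_X_mul, derivative_scaledHermite, gaussFourier_C_mul, h0, h1]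
    simp only [Polynomial.eval_add, Polynomial.eval_mul, Polynomial.eval_C, Polynomial.eval_X]
    push_cast
    have h3 : Complex.I ^ (n + 2) = -Complex.I ^ n := by rw [pow_add, Complex.I_sq]; ring
    have h4 : Complex.I ^ (n + 1) * Complex.I = -Complex.I ^ n := by
      rw [← pow_succ, h3]
    rw [h3]
    generalize Complex.exp (-(1 / 2) * (x : ℂ) ^ 2) = e
    linear_combination (Real.sqrt 2 * x * Real.sqrt (2 * Real.pi) *
      (((scaledHermite (n + 1)).eval x : ℝ) : ℂ) * e) * h4 + ((n + 1) * Real.sqrt (2 * Real.pi) *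
        Complex.I ^ n * (((scaledHermite n).eval x : ℝ) : ℂ) * e) * h2

lemma hermiteFun_eq_scaledHermite (n : ℕ) (y : ℝ) : hermiteFun n y =
    (Real.sqrt (n.factorial * Real.sqrt Real.pi))⁻¹ *
      ((scaledHermite n).eval y * Real.exp (-(1 / 2) * y ^ 2)) := by
  rw [hermiteFun_eq, scaledHermite]
  simp only [Polynomial.eval_mul, Polynomial.eval_C, mul_assoc]

lemma integrable_hermiteFun (n : ℕ) : Integrable (hermiteFun n) := by
  rw [hermiteFun_eq]; exact integrable_poly_gauss _ (by norm_num)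

/-- The Hermite functions are eigenfunctions of the Fourier transform. -/
lemma integral_exp_mul_hermiteFun (n : ℕ) (x : ℝ) :
    ∫ y : ℝ, Complex.exp (Complex.I * ((x * y : ℝ) : ℂ)) * (hermiteFun n y : ℂ) =
      Real.sqrt (2 * Real.pi) * Complex.I ^ n * hermiteFun n x := by
  have h := gaussFourier_scaledHermite x n
  simp_rw [hermiteFun_eq_scaledHermite]
  rw [Complex.ofReal_mul, mul_left_comm, ← h, gaussFourier, ← integral_const_mul]
  refine integral_congr_ae (Filter.Eventually.of_forall fun y => ?_)
  simp only
  rw [Complex.ofReal_mul _ (_ * _), mul_left_comm]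

/-! ### The rotation by `π / 2` as a Fourier transform. -/

lemma fockBasis_apply (n : ℕ) : fockBasis n = fock n := by simp [fockBasis]

lemma ext_inner_fock {ψ φ : Mode 1} (h : ∀ n, ⟪fock n, ψ⟫_ℂ = ⟪fock n, φ⟫_ℂ) : ψ = φ := by
  apply fockBasis.repr.injective
  ext n
  rw [fockBasis.repr_apply_apply, fockBasis.repr_apply_apply, fockBasis_apply, h]

lemma norm_rotation (θ : ℝ) (ψ : Mode 1) : ‖rotation θ ψ‖ = ‖ψ‖ :=
  LinearIsometry.norm_map ((orthonormal_phase_fock θ).orthogonalFamily.linearIsometry.comp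
    fockBasis.repr.toLinearIsometry) ψ

lemma inner_fock_rotation (θ : ℝ) (n : ℕ) (ψ : Mode 1) :
    ⟪fock n, rotation θ ψ⟫_ℂ = Complex.exp (Complex.I * (θ * n : ℝ)) * ⟪fock n, ψ⟫_ℂ := by
  have h := (orthonormal_phase_fock θ).orthogonalFamily.hasSum_linearIsometry (fockBasis.repr ψ)
  have h1 := (h.mapL (innerSL ℂ (fock n))).tsum_eq
  have h2 : rotation θ ψ =
    (orthonormal_phase_fock θ).orthogonalFamily.linearIsometry (fockBasis.repr ψ) := rfl
  rw [innerSL_apply_apply, ← h2] at h1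
  rw [← h1, tsum_eq_single n]
  · rw [innerSL_apply_apply, LinearIsometry.toSpanSingleton_apply, inner_smul_right,
      inner_smul_right, fockBasis.repr_apply_apply, fockBasis_apply,
      inner_self_eq_norm_sq_to_K, orthonormal_fock.1 n]
    simp [mul_comm]
  · intro k hk
    rw [innerSL_apply_apply, LinearIsometry.toSpanSingleton_apply, inner_smul_right,
      inner_smul_right, orthonormal_fock.2 hk.symm, mul_zero, mul_zero]

lemma integral_exp_mul_fock (n : ℕ) (x : ℝ) :
    ∫ y : Fin 1 → ℝ, Complex.exp (Complex.I * ((x * y 0 : ℝ) : ℂ)) * (hermiteFun n (y 0) : ℂ) =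
      Real.sqrt (2 * Real.pi) * Complex.I ^ n * hermiteFun n x := by
  rw [← integral_exp_mul_hermiteFun]
  exact (volume_preserving_funUnique (Fin 1) ℝ).integral_comp'
    (g := fun y : ℝ => Complex.exp (Complex.I * ((x * y : ℝ) : ℂ)) * (hermiteFun n y : ℂ))

/-- On integrable wave functions, the rotation by `π / 2` is given by the Fourier integral. -/
lemma rotation_eq_of_fourier {ψ G : Mode 1} (hψ : Integrable ψ)
    (hG : G =ᵐ[volume] fun x => (Real.sqrt (2 * Real.pi) : ℂ)⁻¹ *
      ∫ y : Fin 1 → ℝ, Complex.exp (Complex.I * ((x 0 * y 0 : ℝ) : ℂ)) * ψ y) :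
    rotation (Real.pi / 2) ψ = G := by
  refine ext_inner_fock fun n => ?_
  have hI : Complex.exp (Complex.I * ((Real.pi / 2 * n : ℝ) : ℂ)) = Complex.I ^ n := by
    conv_rhs => rw [← Complex.exp_pi_div_two_mul_I, ← Complex.exp_nat_mul]
    congr 1
    push_cast; ring
  have hfock : Integrable fun x : Fin 1 → ℝ => (hermiteFun n (x 0) : ℂ) :=
    fock_preserving.integrable_comp_of_integrable ((integrable_hermiteFun n).ofReal (𝕜 := ℂ))
  have hin : ∀ φ : Mode 1, ⟪fock n, φ⟫_ℂ = ∫ x : Fin 1 → ℝ, (hermiteFun n (x 0) : ℂ) * φ x := by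
    intro φ
    rw [L2.inner_def]
    refine integral_congr_ae ?_
    filter_upwards [(memLp_fock n).coeFn_toLp] with x hx
    rw [fock, hx, RCLike.inner_apply, Complex.conj_ofReal, mul_comm]
  have hc : (Real.sqrt (2 * Real.pi) : ℂ) ≠ 0 := by
    have : Real.sqrt (2 * Real.pi) ≠ 0 := (Real.sqrt_pos.mpr (by positivity)).ne'
    exact_mod_cast this
  rw [inner_fock_rotation, hI, hin, hin]
  have h1 : ∫ x : Fin 1 → ℝ, (hermiteFun n (x 0) : ℂ) * G x =
      ∫ x : Fin 1 → ℝ, ∫ y : Fin 1 → ℝ, (Real.sqrt (2 * Real.pi) : ℂ)⁻¹ *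
        (Complex.exp (Complex.I * ((x 0 * y 0 : ℝ) : ℂ)) * ((hermiteFun n (x 0) : ℂ) * ψ y)) := by
    refine integral_congr_ae ?_
    filter_upwards [hG] with x hx
    rw [hx, integral_const_mul, mul_left_comm, ← integral_const_mul]
    congr 1
    refine integral_congr_ae (Filter.Eventually.of_forall fun y => ?_)
    simp only
    ring
  -- Integrability of `ψ` is what permits Fubini here; after the swap the kernel acts on the Hermite
  -- function, an eigenfunction.
  have hint : Integrable (Function.uncurry fun x y : Fin 1 → ℝ =>
      (Real.sqrt (2 * Real.pi) : ℂ)⁻¹ * (Complex.exp (Complex.I * ((x 0 * y 0 : ℝ) : ℂ)) *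
        ((hermiteFun n (x 0) : ℂ) * ψ y))) (volume.prod volume) := by
    refine Integrable.const_mul ?_ _
    refine (hfock.mul_prod hψ).bdd_mul (c := 1) (Continuous.aestronglyMeasurable (by fun_prop))
      (Filter.Eventually.of_forall fun z => ?_)
    rw [mul_comm, Complex.norm_exp_ofReal_mul_I]
  rw [h1, integral_integral_swap hint, ← integral_const_mul]
  refine integral_congr_ae (Filter.Eventually.of_forall fun y => ?_)
  have h2 : ∀ x : Fin 1 → ℝ, (Real.sqrt (2 * Real.pi) : ℂ)⁻¹ *
      (Complex.exp (Complex.I * ((x 0 * y 0 : ℝ) : ℂ)) * ((hermiteFun n (x 0) : ℂ) * ψ y)) =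
      ((Real.sqrt (2 * Real.pi) : ℂ)⁻¹ * ψ y) *
        (Complex.exp (Complex.I * ((y 0 * x 0 : ℝ) : ℂ)) * (hermiteFun n (x 0) : ℂ)) := fun x => by
    rw [mul_comm (x 0)]; ring
  simp_rw [h2]
  rw [integral_const_mul, integral_exp_mul_fock]
  field_simp

/-! ### Wave packets on a single lattice site, and their totality. -/

lemma integral_sssKet_mul_conj {m : ℕ} {μ : Bits m} {k n : Fin m → ℤ} (hk : matchesBits k μ)
    (hn : matchesBits n μ) (z₁ : Fin m → ℝ) :
    ∫ z₂, sssKet k z₁ z₂ * conj (sssKet n z₁ z₂) ∂(cellMeasure m) = if k = n then 1 else 0 := by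
  rw [← inner_cellChar k n μ hk hn, L2.inner_def]
  refine integral_congr_ae ?_
  filter_upwards [(memLp_cellChar k).coeFn_toLp, (memLp_cellChar n).coeFn_toLp] with z h1 h2
  rw [h1, h2, RCLike.inner_apply, sssKet_eq, sssKet_eq, map_mul, Complex.conj_conj,
    mul_mul_mul_comm, mul_comm (cellChar n z)]
  have h3 : Complex.exp (((∑ i, z i * z₁ i / 2 : ℝ) : ℂ) * Complex.I) *
      conj (Complex.exp (((∑ i, z i * z₁ i / 2 : ℝ) : ℂ) * Complex.I)) = 1 := by
    rw [Complex.mul_conj, Complex.normSq_eq_norm_sq, Complex.norm_exp_ofReal_mul_I]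
    simp
  rw [h3, mul_one]

lemma continuous_sssKet {m : ℕ} (n : Fin m → ℤ) :
    Continuous fun z : (Fin m → ℝ) × (Fin m → ℝ) => sssKet n z.1 z.2 := by
  unfold sssKet; fun_prop

/-- The syndrome function whose state of parity `n` is `φ` translated to the lattice site `n`. -/
def siteFun {m : ℕ} (n : Fin m → ℤ) (φ : (Fin m → ℝ) → ℂ) (z : (Fin m → ℝ) × (Fin m → ℝ)) : ℂ :=
  conj (sssKet n z.1 z.2) * φ z.1

lemma memLp_siteFun {m : ℕ} (n : Fin m → ℤ) {φ : (Fin m → ℝ) → ℂ}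
    (hL : MemLp φ 2 (cellMeasure m)) :
    MemLp (siteFun n φ) 2 ((cellMeasure m).prod (cellMeasure m)) := by
  have h1 : MemLp (fun z : (Fin m → ℝ) × (Fin m → ℝ) => φ z.1) 2
      ((cellMeasure m).prod (cellMeasure m)) := hL.comp_fst _
  refine h1.of_le_mul (c := ((Real.sqrt c) ^ m)⁻¹) ?_ (Filter.Eventually.of_forall fun z => ?_)
  · exact (Continuous.aestronglyMeasurable
      (Complex.continuous_conj.comp (continuous_sssKet n))).mul h1.1
  · rw [siteFun, norm_mul, RCLike.norm_conj, norm_sssKet]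

/-- Orthonormality in `z₂` of the kets of equal parity removes every site except `n`. -/
lemma sssFun_siteFun {m : ℕ} {μ : Bits m} {n : Fin m → ℤ} (hn : matchesBits n μ)
    (φ : (Fin m → ℝ) → ℂ) (x : Fin m → ℝ) :
    sssFun μ (siteFun n φ) x = (cell m).indicator φ (x - fun i => c * (n i : ℝ)) := by
  by_cases hx : latticeIndex x = n
  · have h1 : (x - fun i => c * (n i : ℝ)) = residual x := by funext i; simp [residual, hx]
    rw [Set.indicator_of_mem ((latticeIndex_eq_iff x n).mp hx), h1, sssFun, if_pos (hx ▸ hn)]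
    simp only [siteFun, ← mul_assoc]
    rw [integral_mul_const, hx, integral_sssKet_mul_conj hn hn, if_pos rfl, one_mul]
  · rw [Set.indicator_of_notMem fun h => hx ((latticeIndex_eq_iff x n).mpr h), sssFun]
    split_ifs with h
    · simp only [siteFun, ← mul_assoc]
      rw [integral_mul_const, integral_sssKet_mul_conj h hn, if_neg hx, zero_mul]
    · rfl

/-- The functions `siteFun n φ`, with `n` of a fixed parity, span a dense subspace. -/
lemma eq_zero_of_inner_siteFun {m : ℕ} (μ : Bits m) {f : Syndrome m}
    (hf : ∀ (n : Fin m → ℤ) (φ : (Fin m → ℝ) → ℂ) (hL : MemLp φ 2 (cellMeasure m)),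
      matchesBits n μ → ⟪(memLp_siteFun n hL).toLp _, f⟫_ℂ = 0) : f = 0 := by
  have key : ∀ n : Fin m → ℤ, matchesBits n μ →
      ∀ᵐ x : Fin m → ℝ, latticeIndex x = n → sssFun μ f x = 0 := by
    intro n hn
    -- Testing against the piece of the encoded `f` on site `n` itself makes the inner product the
    -- squared norm of that piece.
    let φ : (Fin m → ℝ) → ℂ := fun z => sssFun μ f (z + fun i => c * (n i : ℝ))
    have hL : MemLp φ 2 (cellMeasure m) :=
      ((memLp_sssFun μ f).comp_measurePreserving
        (measurePreserving_add_right volume fun i => c * (n i : ℝ))).restrict _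
    have h0 := hf n φ hL hn
    rw [← inner_sssIncl μ, L2.inner_def] at h0
    have hint := L2.integrable_inner (𝕜 := ℂ) (sssIncl μ ((memLp_siteFun n hL).toLp _))
      (sssIncl μ f)
    have hae : (fun x => ⟪sssIncl μ ((memLp_siteFun n hL).toLp _) x, sssIncl μ f x⟫_ℂ) =ᵐ[volume]
        fun x => ((Set.indicator {x | latticeIndex x = n} (fun x => ‖sssFun μ f x‖ ^ 2) x : ℝ) :
          ℂ) := by
      filter_upwards [coeFn_sssIncl μ f,
        coeFn_sssIncl_of_ae_eq μ (memLp_siteFun n hL).coeFn_toLp] with x h1 h2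
      rw [h1, h2, sssFun_siteFun hn]
      by_cases hx : latticeIndex x = n
      · rw [Set.indicator_of_mem ((latticeIndex_eq_iff x n).mp hx),
          Set.indicator_of_mem (show x ∈ {x | latticeIndex x = n} from hx)]
        simp only [φ, sub_add_cancel, RCLike.inner_apply]
        rw [Complex.mul_conj, Complex.normSq_eq_norm_sq]
      · rw [Set.indicator_of_notMem fun h => hx ((latticeIndex_eq_iff x n).mpr h),
          Set.indicator_of_notMem (show x ∉ {x | latticeIndex x = n} from hx)]
        simp
    rw [integral_congr_ae hae, integral_complex_ofReal, Complex.ofReal_eq_zero,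
      integral_eq_zero_iff_of_nonneg] at h0
    · filter_upwards [h0] with x hx hxn
      rw [Set.indicator_of_mem (show x ∈ {x | latticeIndex x = n} from hxn)] at hx
      simpa using hx
    · intro x
      exact Set.indicator_nonneg (fun _ _ => by positivity) x
    · have := (hint.congr hae).re
      simpa using this
  have h0 : sssIncl μ f = 0 := by
    refine Lp.ext ?_
    have hall : ∀ᵐ x : Fin m → ℝ, ∀ n : Fin m → ℤ, matchesBits n μ → latticeIndex x = n →
        sssFun μ f x = 0 := by
      rw [ae_all_iff]
      intro n
      by_cases hn : matchesBits n μ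
      · filter_upwards [key n hn] with x hx _ using hx
      · exact Filter.Eventually.of_forall fun x h => absurd h hn
    filter_upwards [coeFn_sssIncl μ f, hall, Lp.coeFn_zero ℂ 2 (volume : Measure (Fin m → ℝ))]
      with x h1 h2 h3
    rw [h1, h3, Pi.zero_apply]
    by_cases hx : matchesBits (latticeIndex x) μ
    · exact h2 _ hx rfl
    · rw [sssFun, if_neg hx]
  rw [← norm_eq_zero, ← norm_sssIncl μ, h0, norm_zero]

/-- Two continuous linear maps on the syndromes agree if they agree on all `siteFun n φ`. -/
lemma clm_ext_siteFun {m : ℕ} (μ : Bits m) {A B : Syndrome m →L[ℂ] Mode m}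
    (h : ∀ (n : Fin m → ℤ) (φ : (Fin m → ℝ) → ℂ) (hL : MemLp φ 2 (cellMeasure m)),
      matchesBits n μ → A ((memLp_siteFun n hL).toLp _) = B ((memLp_siteFun n hL).toLp _)) :
    A = B := by
  let S : Submodule ℂ (Syndrome m) := LinearMap.eqLocus A.toLinearMap B.toLinearMap
  have hS : IsClosed (S : Set (Syndrome m)) := isClosed_eq A.continuous B.continuous
  have hperp : Sᗮ = ⊥ := by
    rw [Submodule.eq_bot_iff]
    intro f hf
    refine eq_zero_of_inner_siteFun μ fun n φ hL hn => ?_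
    exact (Submodule.mem_orthogonal S f).mp hf _ (h n φ hL hn)
  have htop : S = ⊤ := by
    rw [← hS.submodule_topologicalClosure_eq, Submodule.topologicalClosure_eq_top_iff, hperp]
  ext1 g
  have : g ∈ S := by rw [htop]; trivial
  exact this

/-! ### The rotation as Hadamard tensored with a quarter turn of the syndrome. -/

lemma measurePreserving_neg_cell (m : ℕ) :
    MeasurePreserving (fun z : Fin m → ℝ => -z) (cellMeasure m) (cellMeasure m) := by
  have h := (Measure.measurePreserving_neg (volume : Measure (Fin m → ℝ))).restrict_preimage
    (measurableSet_cell m)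
  have h2 : (Neg.neg ⁻¹' cell m : Set (Fin m → ℝ)) =ᵐ[volume] cell m := by
    refine Filter.EventuallyEq.trans ?_ (cell_ae_eq_Ioc m).symm
    have hset : (Neg.neg ⁻¹' cell m : Set (Fin m → ℝ)) =
        {z | ∀ i, z i ∈ Set.Ioc (-(c / 2)) (c / 2)} := ?_
    · exact Filter.EventuallyEq.of_eq hset
    ext z
    simp only [cell, Set.mem_preimage, Set.mem_univ_pi, Set.mem_Ico, Set.mem_Ioc, Pi.neg_apply,
      Set.mem_ofPred_eq]
    refine forall_congr' fun i => ?_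
    constructor <;> rintro ⟨h1, h2⟩ <;> constructor <;> linarith
  rw [Measure.restrict_congr_set h2] at h
  exact h

lemma measurePreserving_quarterTurn (m : ℕ) :
    MeasurePreserving (fun z : (Fin m → ℝ) × (Fin m → ℝ) => (z.2, -z.1))
      ((cellMeasure m).prod (cellMeasure m)) ((cellMeasure m).prod (cellMeasure m)) :=
  ((MeasurePreserving.id (cellMeasure m)).prod (measurePreserving_neg_cell m)).comp
    Measure.measurePreserving_swap

/-- The rotation of the syndromes by a quarter turn. -/
def quarterTurn (m : ℕ) : Syndrome m →L[ℂ] Syndrome m :=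
  (Lp.compMeasurePreservingₗᵢ ℂ (fun z : (Fin m → ℝ) × (Fin m → ℝ) => (z.2, -z.1))
    (measurePreserving_quarterTurn m)).toContinuousLinearMap

lemma coeFn_quarterTurn {m : ℕ} (g : Syndrome m) :
    quarterTurn m g =ᵐ[(cellMeasure m).prod (cellMeasure m)] fun z => g (z.2, -z.1) :=
  Lp.coeFn_compMeasurePreserving g (measurePreserving_quarterTurn m)

lemma logical_H (ν μ : Bits 1) : Gate.H.logical ν μ =
    (Real.sqrt 2 : ℂ)⁻¹ * (-1) ^ ((ν 0 : ℕ) * (μ 0 : ℕ)) := by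
  simp only [Gate.logical, oneQubit, Matrix.of_apply]
  generalize ν 0 = a
  generalize μ 0 = b
  fin_cases a <;> fin_cases b <;> simp

/-- Since `c² = π`, the Fourier kernel between two lattice sites is `(-1) ^ (k n)` and sees only
parities: it is the sign of a Hadamard entry. -/
lemma exp_lattice_mul {k n : Fin 1 → ℤ} {ν μ : Bits 1} (hk : matchesBits k ν)
    (hn : matchesBits n μ) : Complex.exp (Complex.I * ((c * k 0 * (c * n 0) : ℝ) : ℂ)) =
      (-1) ^ ((ν 0 : ℕ) * (μ 0 : ℕ)) := by
  obtain ⟨a, ha⟩ : ∃ a : ℤ, k 0 = ((ν 0 : ℕ) : ℤ) + 2 * a := ⟨k 0 / 2, by have := hk 0; omega⟩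
  obtain ⟨b, hb⟩ : ∃ b : ℤ, n 0 = ((μ 0 : ℕ) : ℤ) + 2 * b := ⟨n 0 / 2, by have := hn 0; omega⟩
  have h : Complex.I * ((c * k 0 * (c * n 0) : ℝ) : ℂ) =
      (((ν 0 : ℕ) * (μ 0 : ℕ) : ℕ) : ℂ) * (Real.pi * Complex.I) +
        ((a * (μ 0 : ℕ) + b * (ν 0 : ℕ) + 2 * a * b : ℤ) : ℂ) * (2 * Real.pi * Complex.I) := by
    rw [mul_mul_mul_comm, c_sq, ha, hb]; push_cast; ring
  rw [h, Complex.exp_add, Complex.exp_int_mul_two_pi_mul_I, mul_one, Complex.exp_nat_mul,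
    Complex.exp_pi_mul_I]

lemma rotation_sssIncl_siteFun {μ : Bits 1} {n : Fin 1 → ℤ} (hn : matchesBits n μ)
    {φ : (Fin 1 → ℝ) → ℂ} (hL : MemLp φ 2 (cellMeasure 1)) :
    rotation (Real.pi / 2) (sssIncl μ ((memLp_siteFun n hL).toLp _)) =
      ∑ ν, Gate.H.logical ν μ • sssIncl ν (quarterTurn 1 ((memLp_siteFun n hL).toLp _)) := by
  have hψ := coeFn_sssIncl_of_ae_eq μ (memLp_siteFun n hL).coeFn_toLp
  have hφint : Integrable ((cell 1).indicator φ) := by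
    rw [integrable_indicator_iff (measurableSet_cell 1)]
    exact hL.integrable (by norm_num)
  refine rotation_eq_of_fourier ?_ ?_
  · refine (hφint.comp_sub_right fun i => c * (n i : ℝ)).congr ?_
    filter_upwards [hψ] with x hx
    rw [hx, sssFun_siteFun hn]
  · have hcoe : quarterTurn 1 ((memLp_siteFun n hL).toLp _) =ᵐ[(cellMeasure 1).prod (cellMeasure 1)]
        fun z => siteFun n φ (z.2, -z.1) := by
      filter_upwards [coeFn_quarterTurn ((memLp_siteFun n hL).toLp _),
        (measurePreserving_quarterTurn 1).quasiMeasurePreserving.ae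
          (memLp_siteFun n hL).coeFn_toLp] with z h1 h2
      rw [h1, h2]
    have hsum : ∀ᵐ x : Fin 1 → ℝ,
        (∑ ν, Gate.H.logical ν μ • sssIncl ν (quarterTurn 1 ((memLp_siteFun n hL).toLp _)) :
          Mode 1) x =
        ∑ ν, Gate.H.logical ν μ * sssFun ν (fun z => siteFun n φ (z.2, -z.1)) x := by
      have h1 : ∀ᵐ x : Fin 1 → ℝ, ∀ ν : Bits 1,
          (Gate.H.logical ν μ • sssIncl ν (quarterTurn 1 ((memLp_siteFun n hL).toLp _)) :
            Mode 1) x = Gate.H.logical ν μ * sssFun ν (fun z => siteFun n φ (z.2, -z.1)) x := by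
        rw [ae_all_iff]
        intro ν
        filter_upwards [Lp.coeFn_smul (Gate.H.logical ν μ)
          (sssIncl ν (quarterTurn 1 ((memLp_siteFun n hL).toLp _))),
          coeFn_sssIncl_of_ae_eq ν hcoe] with x e1 e2
        rw [e1, Pi.smul_apply, e2, smul_eq_mul]
      filter_upwards [h1, Lp.coeFn_finsetSum (Finset.univ : Finset (Bits 1)) fun ν =>
        Gate.H.logical ν μ • sssIncl ν (quarterTurn 1 ((memLp_siteFun n hL).toLp _))] with x e1 e2
      rw [e2, Finset.sum_apply]
      exact Finset.sum_congr rfl fun ν _ => e1 ν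
    filter_upwards [hsum] with x hx
    rw [hx]
    have hF : ∫ y : Fin 1 → ℝ, Complex.exp (Complex.I * ((x 0 * y 0 : ℝ) : ℂ)) *
        sssIncl μ ((memLp_siteFun n hL).toLp _) y =
        ∫ z, Complex.exp (Complex.I * ((x 0 * (z 0 + c * n 0) : ℝ) : ℂ)) * φ z
          ∂(cellMeasure 1) := by
      have h1 : ∫ y : Fin 1 → ℝ, Complex.exp (Complex.I * ((x 0 * y 0 : ℝ) : ℂ)) *
          sssIncl μ ((memLp_siteFun n hL).toLp _) y =
          ∫ y : Fin 1 → ℝ, (fun z : Fin 1 → ℝ =>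
            Complex.exp (Complex.I * ((x 0 * (z 0 + c * n 0) : ℝ) : ℂ)) *
              (cell 1).indicator φ z) (y - fun i => c * (n i : ℝ)) := by
        refine integral_congr_ae ?_
        filter_upwards [hψ] with y hy
        rw [hy, sssFun_siteFun hn]
        simp only [Pi.sub_apply, sub_add_cancel]
      refine h1.trans ((integral_sub_right_eq_self (μ := (volume : Measure (Fin 1 → ℝ)))
        (fun z : Fin 1 → ℝ => Complex.exp (Complex.I * ((x 0 * (z 0 + c * n 0) : ℝ) : ℂ)) *
          (cell 1).indicator φ z) _).trans ?_)
      rw [cellMeasure, ← integral_indicator (measurableSet_cell 1)]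
      refine integral_congr_ae (Filter.Eventually.of_forall fun z => ?_)
      by_cases hz : z ∈ cell 1 <;> simp [hz]
    rw [hF]
    -- At a given position only the summand with the parity of its lattice index is nonzero.
    obtain ⟨ν, hν⟩ : ∃ ν : Bits 1, matchesBits (latticeIndex x) ν :=
      ⟨fun i => ⟨(latticeIndex x i % 2).toNat, by omega⟩, fun i => by dsimp only; omega⟩
    rw [Finset.sum_eq_single_of_mem ν (Finset.mem_univ _)]
    swap
    · intro ν' _ hne
      rw [sssFun, if_neg, mul_zero]
      intro h
      refine hne (funext fun i => Fin.ext ?_)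
      have h1 := hν i
      have h2 := h i
      omega
    rw [sssFun, if_pos hν, ← integral_const_mul, ← integral_const_mul]
    refine integral_congr_ae (Filter.Eventually.of_forall fun z => ?_)
    simp only [siteFun, sssKet, Fin.sum_univ_one, pow_one, map_mul, ← Complex.exp_conj,
      Complex.conj_I, Complex.conj_ofReal, Pi.neg_apply, Complex.ofReal_inv, map_inv₀]
    have hx0 : x 0 = residual x 0 + c * latticeIndex x 0 := by simp [residual]
    rw [logical_H, ← exp_lattice_mul hν hn]
    set k := latticeIndex x
    set z₁ := residual x
    rw [hx0]
    have hc := c_pos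
    -- Since `√π = c`, the Fourier normalization is the `1/√2` of the Hadamard matrix times the
    -- normalizations of the two kets.
    have hs : (Real.sqrt (2 * Real.pi) : ℂ)⁻¹ =
        (Real.sqrt 2 : ℂ)⁻¹ * ((Real.sqrt c : ℂ)⁻¹ * (Real.sqrt c : ℂ)⁻¹) := by
      rw [Real.sqrt_mul (by norm_num), ← mul_inv, ← Complex.ofReal_mul (Real.sqrt c),
        Real.mul_self_sqrt hc.le, Complex.ofReal_mul, mul_inv]
      rfl
    -- The cross term `z₁ z` is shared equally between the two kets; the minus sign in the quarter
    -- turn absorbs the conjugation of the second one.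
    have he : Complex.exp (Complex.I * (((z₁ 0 + c * k 0) * (z 0 + c * n 0) : ℝ) : ℂ)) =
        Complex.exp (Complex.I * ((c * k 0 * (c * n 0) : ℝ) : ℂ)) *
        (Complex.exp (Complex.I * ((z 0 * (z₁ 0 / 2 + c * k 0) : ℝ) : ℂ)) *
          Complex.exp (-Complex.I * ((-z₁ 0 * (z 0 / 2 + c * n 0) : ℝ) : ℂ))) := by
      rw [← Complex.exp_add, ← Complex.exp_add]
      congr 1
      push_cast
      ring
    rw [hs, he]
    ring

lemma rotation_sssIncl (μ : Bits 1) (g : Syndrome 1) :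
    rotation (Real.pi / 2) (sssIncl μ g) =
      ∑ ν, Gate.H.logical ν μ • sssIncl ν (quarterTurn 1 g) := by
  have h : rotation (Real.pi / 2) ∘L sssIncl μ =
      ∑ ν, Gate.H.logical ν μ • (sssIncl ν ∘L quarterTurn 1) := by
    refine clm_ext_siteFun μ fun n φ hL hn => ?_
    rw [ContinuousLinearMap.comp_apply, rotation_sssIncl_siteFun hn hL]
    simp
  have := congrArg (fun A => A g) h
  simpa using this

lemma exists_H_sssIncl {r : Fin 1 → ℝ} (g : Syndrome 1) :
    ∃ h : Syndrome 1, squareProj r h = h ∧ ∀ μ, Gate.H.physical (sssIncl μ (squareProj r g)) =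
      ∑ ν, Gate.H.logical ν μ • sssIncl ν h := by
  refine ⟨quarterTurn 1 (squareProj r g), squareProj_eq_self ?_, fun μ => rotation_sssIncl μ _⟩
  filter_upwards [coeFn_quarterTurn (squareProj r g),
    (measurePreserving_quarterTurn 1).quasiMeasurePreserving.ae (coeFn_squareProj r g)]
    with z h1 h2 hz
  rw [h1, h2, Set.indicator_of_notMem]
  refine fun h => hz fun i => ?_
  have := h i
  simp only [Pi.neg_apply, abs_neg] at this
  exact ⟨this.2, this.1⟩

/-! ### Traces and channels on absolutely convergent sums of rank-one operators. -/

section Trace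

/-- Cauchy–Schwarz, in the form needed both for basis coefficients (by Bessel) and for the norms `‖K
k ψ‖` (by trace preservation). -/
lemma summable_mul_of_sq_le {ι : Type*} {u v : ι → ℝ} {A B : ℝ} (hu : ∀ i, 0 ≤ u i)
    (hv : ∀ i, 0 ≤ v i) (hA : 0 ≤ A) (hB : 0 ≤ B) (hsu : Summable fun i => u i ^ 2)
    (hsv : Summable fun i => v i ^ 2) (hu2 : ∑' i, u i ^ 2 ≤ A ^ 2) (hv2 : ∑' i, v i ^ 2 ≤ B ^ 2) :
    Summable (fun i => u i * v i) ∧ ∑' i, u i * v i ≤ A * B := by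
  constructor
  · refine Summable.of_nonneg_of_le (fun i => mul_nonneg (hu i) (hv i)) (fun i => ?_) (hsu.add hsv)
    nlinarith [sq_nonneg (u i - v i), sq_nonneg (u i), sq_nonneg (v i)]
  · have h := Real.inner_le_Lp_mul_Lq_tsum_of_nonneg (p := 2) (q := 2) Real.HolderConjugate.two_two
      hu hv (by simpa using hsu) (by simpa using hsv)
    simp only [Real.rpow_ofNat, ← Real.sqrt_eq_rpow] at h
    refine h.trans (mul_le_mul ?_ ?_ (Real.sqrt_nonneg _) hA)
    · exact Real.sqrt_le_iff.mpr ⟨hA, hu2⟩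
    · exact Real.sqrt_le_iff.mpr ⟨hB, hv2⟩

variable {E F : Type*} [NormedAddCommGroup E] [InnerProductSpace ℂ E]
  [NormedAddCommGroup F] [InnerProductSpace ℂ F]

lemma summable_norm_map {ι : Type*} {a b : ι → E} (hs : Summable fun k => ‖a k‖ * ‖b k‖)
    (A B : E →L[ℂ] F) : Summable fun k => ‖A (a k)‖ * ‖B (b k)‖ := by
  refine Summable.of_nonneg_of_le (fun k => by positivity) (fun k => ?_)
    (hs.mul_left (‖A‖ * ‖B‖))
  calc ‖A (a k)‖ * ‖B (b k)‖ ≤ (‖A‖ * ‖a k‖) * (‖B‖ * ‖b k‖) :=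
        mul_le_mul (A.le_opNorm _) (B.le_opNorm _) (norm_nonneg _) (by positivity)
    _ = ‖A‖ * ‖B‖ * (‖a k‖ * ‖b k‖) := by ring

/-- Kraus operators with `∑ k, (K k)† K k = 1` preserve inner products on average. -/
lemma hasSum_inner_of_hasSum_norm_sq {K : ℕ → E →L[ℂ] E}
    (hK : ∀ ψ, HasSum (fun k => ‖K k ψ‖ ^ 2) (‖ψ‖ ^ 2)) (ψ φ : E) :
    HasSum (fun k => ⟪K k ψ, K k φ⟫_ℂ) ⟪ψ, φ⟫_ℂ := by
  have h : ∀ χ, HasSum (fun k => (‖K k χ‖ : ℂ) ^ 2) ((‖χ‖ : ℂ) ^ 2) := fun χ => by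
    have := (hK χ).mapL Complex.ofRealCLM
    simpa using this
  have h1 := (((h (ψ + φ)).sub (h (ψ - φ))).add (((h (ψ - RCLike.I (K := ℂ) • φ)).sub
    (h (ψ + RCLike.I (K := ℂ) • φ))).mul_right (RCLike.I (K := ℂ)))).div_const 4
  rw [inner_eq_sum_norm_sq_div_four]
  refine h1.congr_fun fun k => ?_
  rw [inner_eq_sum_norm_sq_div_four]
  simp only [map_add, map_sub, map_smul]
  rfl

variable [CompleteSpace E]

lemma hasSum_comp_comp {ι : Type*} {f : ι → E →L[ℂ] E} {T : E →L[ℂ] E} (h : HasSum f T)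
    (A : E →L[ℂ] F) (B : F →L[ℂ] E) : HasSum (fun k => A ∘L f k ∘L B) (A ∘L T ∘L B) :=
  h.mapL ((ContinuousLinearMap.compL ℂ F E F A) ∘L ((ContinuousLinearMap.compL ℂ F E E).flip B))

variable [CompleteSpace F]

/-- The trace of an absolutely convergent sum `∑ k, |a k⟩⟨b k|` is `∑ k, ⟨b k, a k⟩`. -/
lemma hasSum_opTrace {ι : Type*} {a b : ι → E} {T : E →L[ℂ] E}
    (hs : Summable fun k => ‖a k‖ * ‖b k‖)
    (hT : HasSum (fun k => InnerProductSpace.rankOne ℂ (a k) (b k)) T) :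
    HasSum (fun k => ⟪b k, a k⟫_ℂ) (opTrace T) := by
  rw [opTrace]
  generalize (exists_hilbertBasis ℂ E).choose_spec.choose = e
  -- This bound makes the double series over rank-one terms and basis vectors absolutely convergent;
  -- the two orders of summation give the two sides.
  have hfib : ∀ k, Summable (fun i => ‖⟪b k, e i⟫_ℂ * ⟪e i, a k⟫_ℂ‖) ∧
      ∑' i, ‖⟪b k, e i⟫_ℂ * ⟪e i, a k⟫_ℂ‖ ≤ ‖b k‖ * ‖a k‖ := fun k => by
    simp only [norm_mul, norm_inner_symm (b k)]
    exact summable_mul_of_sq_le (fun _ => norm_nonneg _) (fun _ => norm_nonneg _) (norm_nonneg _)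
      (norm_nonneg _) (e.orthonormal.inner_products_summable _)
      (e.orthonormal.inner_products_summable _) (e.orthonormal.tsum_inner_products_le _)
      (e.orthonormal.tsum_inner_products_le _)
  have hsum : Summable fun p : ι × _ => ⟪b p.1, e p.2⟫_ℂ * ⟪e p.2, a p.1⟫_ℂ := by
    refine Summable.of_norm ((summable_prod_of_nonneg fun _ => norm_nonneg _).mpr
      ⟨fun k => (hfib k).1, ?_⟩)
    refine Summable.of_nonneg_of_le (fun k => tsum_nonneg fun i => norm_nonneg _)
      (fun k => (hfib k).2) ?_
    simpa only [mul_comm] using hs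
  have h1 := hsum.hasSum.prod_fiberwise fun k => e.hasSum_inner_mul_inner (b k) (a k)
  have hswap := ((Equiv.prodComm _ _).hasSum_iff.mpr hsum.hasSum :
    HasSum ((fun p : ι × _ => ⟪b p.1, e p.2⟫_ℂ * ⟪e p.2, a p.1⟫_ℂ) ∘ Equiv.prodComm _ ι) _)
  have h2 := hswap.prod_fiberwise fun i => by
    have h3 : HasSum (fun k => ⟪e i, InnerProductSpace.rankOne ℂ (a k) (b k) (e i)⟫_ℂ)
        ⟪e i, T (e i)⟫_ℂ :=
      (hT.mapL (ContinuousLinearMap.apply ℂ E (e i))).mapL (innerSL ℂ (e i))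
    simp only [InnerProductSpace.rankOne_apply, inner_smul_right] at h3
    exact h3
  rw [h2.tsum_eq]
  exact h1

lemma hasSum_rankOne_comp {ι : Type*} {a b : ι → E} {T : E →L[ℂ] E}
    (h : HasSum (fun k => InnerProductSpace.rankOne ℂ (a k) (b k)) T) (A B : E →L[ℂ] F) :
    HasSum (fun k => InnerProductSpace.rankOne ℂ (A (a k)) (B (b k)))
      (A ∘L T ∘L ContinuousLinearMap.adjoint B) := by
  have := hasSum_comp_comp h A (ContinuousLinearMap.adjoint B)
  simpa only [InnerProductSpace.rankOne_comp, InnerProductSpace.comp_rankOne,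
    ContinuousLinearMap.adjoint_adjoint] using this

lemma isTraceClass_conjBy {T : E →L[ℂ] E} (hT : IsTraceClass T) (A : E →L[ℂ] E) :
    IsTraceClass (conjBy A T) := by
  obtain ⟨a, b, hs, h⟩ := hT
  exact ⟨fun k => A (a k), fun k => A (b k), summable_norm_map hs A A, hasSum_rankOne_comp h A A⟩

lemma conjBy_conjBy (A B T : E →L[ℂ] E) : conjBy A (conjBy B T) = conjBy (A ∘L B) T := by
  simp only [conjBy, ContinuousLinearMap.adjoint_comp]
  rfl

/-- The output of a channel on `∑ j, |a j⟩⟨b j|`, as an absolutely convergent double sum. -/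
lemma hasSum_kraus_rankOne {K : ℕ → E →L[ℂ] E}
    (hK : ∀ ψ, HasSum (fun k => ‖K k ψ‖ ^ 2) (‖ψ‖ ^ 2)) {a b : ℕ → E} {T S : E →L[ℂ] E}
    (hs : Summable fun j => ‖a j‖ * ‖b j‖)
    (hT : HasSum (fun j => InnerProductSpace.rankOne ℂ (a j) (b j)) T)
    (hS : HasSum (fun k => conjBy (K k) T) S) :
    (Summable fun p : ℕ × ℕ => ‖K p.2 (a p.1)‖ * ‖K p.2 (b p.1)‖) ∧
      HasSum (fun p : ℕ × ℕ => InnerProductSpace.rankOne ℂ (K p.2 (a p.1)) (K p.2 (b p.1))) S := by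
  have hfib : ∀ j, Summable (fun k => ‖K k (a j)‖ * ‖K k (b j)‖) ∧
      ∑' k, ‖K k (a j)‖ * ‖K k (b j)‖ ≤ ‖a j‖ * ‖b j‖ := fun j =>
    summable_mul_of_sq_le (fun _ => norm_nonneg _) (fun _ => norm_nonneg _) (norm_nonneg _)
      (norm_nonneg _) (hK _).summable (hK _).summable (hK _).tsum_eq.le (hK _).tsum_eq.le
  have h1 : Summable fun p : ℕ × ℕ => ‖K p.2 (a p.1)‖ * ‖K p.2 (b p.1)‖ :=
    (summable_prod_of_nonneg fun _ => by positivity).mpr ⟨fun j => (hfib j).1,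
      Summable.of_nonneg_of_le (fun j => tsum_nonneg fun k => by positivity)
        (fun j => (hfib j).2) hs⟩
  refine ⟨h1, ?_⟩
  have h2 : Summable fun p : ℕ × ℕ =>
      InnerProductSpace.rankOne ℂ (K p.2 (a p.1)) (K p.2 (b p.1)) :=
    Summable.of_norm (by simpa only [InnerProductSpace.norm_rankOne] using h1)
  -- Summing over `j` first recovers the Kraus terms, which identifies the value of the double sum
  -- as `S`.
  have h3 := (Equiv.prodComm ℕ ℕ).hasSum_iff.mpr h2.hasSum
  have h4 := h3.prod_fiberwise fun k => hasSum_rankOne_comp hT (K k) (K k)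
  rw [hS.unique h4]
  exact h2.hasSum

end Trace

/-! ### Passing from displacements to their weak limits. -/

section Closure

variable {m : ℕ} {s : ℝ}

/-- Matrix elements are continuous in the weak operator topology, so linear relations between
them extend from the displacements to their generalized linear combinations. -/
lemma IsDisplacementCombination.inner_eq {A : Mode m →L[ℂ] Mode m}
    (hA : IsDisplacementCombination s A) {f f' ψ ψ' : Mode m}
    (h : ∀ v₁ v₂ : Fin m → ℝ, (∀ i, v₁ i ∈ Set.Ico (-s) s ∧ v₂ i ∈ Set.Ico (-s) s) →
      ⟪f, displacement v₁ v₂ ψ⟫_ℂ = ⟪f', displacement v₁ v₂ ψ'⟫_ℂ) :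
    ⟪f, A ψ⟫_ℂ = ⟪f', A ψ'⟫_ℂ := by
  have hcl : IsClosed {B : Mode m →WOT[ℂ] Mode m | innerSL ℂ f (B ψ) = innerSL ℂ f' (B ψ')} :=
    isClosed_eq (ContinuousLinearMapWOT.continuous_dual_apply ψ (innerSL ℂ f))
      (ContinuousLinearMapWOT.continuous_dual_apply ψ' (innerSL ℂ f'))
  have hsub : ContinuousLinearMapWOT.ofCLM '' (displacementSpan m s : Set (Mode m →L[ℂ] Mode m)) ⊆
      {B : Mode m →WOT[ℂ] Mode m | innerSL ℂ f (B ψ) = innerSL ℂ f' (B ψ')} := by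
    rintro _ ⟨B, hB, rfl⟩
    change ⟪f, B ψ⟫_ℂ = ⟪f', B ψ'⟫_ℂ
    induction hB using Submodule.span_induction with
    | mem B hB =>
      obtain ⟨v₁, v₂, hv, rfl⟩ := hB
      exact h v₁ v₂ hv
    | zero => simp
    | add B C _ _ hB hC => simp [inner_add_right, hB, hC]
    | smul t B _ hB => simp [inner_smul_right, hB]
  exact closure_minimal hsub hcl hA

/-- With `s ≤ 0` the interval `[-s, s)` is empty, so no displacement is allowed. A mode `i` must
exist: with none, the condition on components would be vacuous. -/
lemma IsDisplacementCombination.eq_zero {A : Mode m →L[ℂ] Mode m}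
    (hA : IsDisplacementCombination s A) (hs : s ≤ 0) (i : Fin m) : A = 0 := by
  ext1 ψ
  refine ext_inner_left ℂ fun f => ?_
  rw [hA.inner_eq (f' := 0) (ψ' := 0)]
  · simp
  · intro v₁ v₂ hv
    have := (hv i).1
    exact absurd (this.1.trans_lt this.2) (by linarith)

lemma sssFilter_apply (r : Fin m → ℝ) (ψ : Mode m) : sssFilter r ψ =
    ∑ μ : Bits m, sssIncl μ (squareProj r (ContinuousLinearMap.adjoint (sssIncl μ) ψ)) := by
  simp [sssFilter, squareProj]

lemma sssFilter_sssIncl (r : Fin m → ℝ) (μ : Bits m) (g : Syndrome m) :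
    sssFilter r (sssIncl μ g) = sssIncl μ (squareProj r g) := by
  rw [sssFilter_apply, Finset.sum_eq_single_of_mem μ (Finset.mem_univ _)]
  · rw [adjoint_sssIncl_apply]
  · intro ν _ hν
    rw [adjoint_sssIncl_apply_of_ne hν, map_zero, map_zero]

/-- The syndrome states produced by individual displacements need not converge along with the
operators. The conclusion is therefore split into linear relations between matrix elements,
preserved by weak limits: vanishing off-diagonal blocks (`hne`), equal diagonal blocks (`heq`) and
invariance of the output under the larger filter (`hfil`). -/
lemma IsDisplacementCombination.exists_sssIncl {r R : Fin m → ℝ} {A : Mode m →L[ℂ] Mode m}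
    (hA : IsDisplacementCombination s A) (hs : 0 ≤ s) (hrR : ∀ i, r i + s ≤ R i)
    (hR : ∀ i, R i ≤ c / 2) (g : Syndrome m) :
    ∃ h : Syndrome m, squareProj R h = h ∧
      ∀ μ, A (sssIncl μ (squareProj r g)) = sssIncl μ h := by
  have hV : ∀ v₁ v₂ : Fin m → ℝ, (∀ i, v₁ i ∈ Set.Ico (-s) s ∧ v₂ i ∈ Set.Ico (-s) s) →
      ∃ h : Syndrome m, squareProj R h = h ∧
        ∀ μ, displacement v₁ v₂ (sssIncl μ (squareProj r g)) = sssIncl μ h := fun v₁ v₂ hv =>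
    exists_displacement_sssIncl hs hrR hR (fun i =>
      ⟨abs_le.mpr ⟨(hv i).1.1, (hv i).1.2.le⟩, abs_le.mpr ⟨(hv i).2.1, (hv i).2.2.le⟩⟩) g
  have hne : ∀ μ ν, μ ≠ ν → ContinuousLinearMap.adjoint (sssIncl μ)
      (A (sssIncl ν (squareProj r g))) = 0 := by
    intro μ ν hμν
    refine ext_inner_left ℂ fun f => ?_
    rw [ContinuousLinearMap.adjoint_inner_right, inner_zero_right,
      hA.inner_eq (f' := 0) (ψ' := 0), inner_zero_left]
    intro v₁ v₂ hv
    obtain ⟨h, -, h2⟩ := hV v₁ v₂ hv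
    rw [h2, inner_sssIncl_of_ne hμν, inner_zero_left]
  have heq : ∀ μ ν, ContinuousLinearMap.adjoint (sssIncl μ) (A (sssIncl μ (squareProj r g))) =
      ContinuousLinearMap.adjoint (sssIncl ν) (A (sssIncl ν (squareProj r g))) := by
    intro μ ν
    refine ext_inner_left ℂ fun f => ?_
    rw [ContinuousLinearMap.adjoint_inner_right, ContinuousLinearMap.adjoint_inner_right]
    refine hA.inner_eq fun v₁ v₂ hv => ?_
    obtain ⟨h, -, h2⟩ := hV v₁ v₂ hv
    rw [h2, h2, inner_sssIncl, inner_sssIncl]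
  have hfil : ∀ μ, sssFilter R (A (sssIncl μ (squareProj r g))) =
      A (sssIncl μ (squareProj r g)) := by
    intro μ
    refine ext_inner_left ℂ fun f => ?_
    rw [← ContinuousLinearMap.adjoint_inner_left]
    refine hA.inner_eq fun v₁ v₂ hv => ?_
    obtain ⟨h, h1, h2⟩ := hV v₁ v₂ hv
    rw [ContinuousLinearMap.adjoint_inner_left, h2, sssFilter_sssIncl, h1]
  -- All diagonal blocks agree, so the one at logical zero serves as the witness; projecting it
  -- makes its support evident.
  refine ⟨squareProj R (ContinuousLinearMap.adjoint (sssIncl fun _ => 0)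
    (A (sssIncl (fun _ => 0) (squareProj r g)))), squareProj_squareProj R _, fun μ => ?_⟩
  rw [← hfil μ, sssFilter_apply, Finset.sum_eq_single_of_mem μ (Finset.mem_univ _)]
  · rw [heq μ]
  · intro ν _ hν
    rw [hne ν μ hν, map_zero, map_zero]

end Closure

/-! ### Noisy gates as qubit operators tensored with maps of syndromes. -/

lemma norm_displacement {m : ℕ} (v₁ v₂ : Fin m → ℝ) (ψ : Mode m) :
    ‖displacement v₁ v₂ ψ‖ = ‖ψ‖ := by
  have h : eLpNorm (displacement v₁ v₂ ψ) 2 volume =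
      eLpNorm (ψ ∘ fun x : Fin m → ℝ => x - v₁) 2 volume := by
    refine eLpNorm_congr_norm_ae ?_
    filter_upwards [coeFn_displacement v₁ v₂ ψ] with x hx
    rw [hx, norm_mul, mul_comm Complex.I, Complex.norm_exp_ofReal_mul_I, one_mul]
    rfl
  rw [Lp.norm_def, Lp.norm_def, h, eLpNorm_comp_measurePreserving (Lp.aestronglyMeasurable ψ)
    (measurePreserving_sub_right volume v₁)]

lemma Gate.norm_physical {m : ℕ} (U : Gate m) (ψ : Mode m) : ‖U.physical ψ‖ = ‖ψ‖ := by
  cases U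
  · exact norm_displacement _ _ ψ
  · exact norm_displacement _ _ ψ
  · exact norm_rotation _ ψ
  · rfl
  · exact (Lp.compMeasurePreservingₗᵢ ℂ _ shear_preserving).norm_map ψ

lemma sum_bits_one (f : Bits 1 → ℂ) : ∑ ν, f ν = f (fun _ => 0) + f (fun _ => 1) := by
  rw [← (Equiv.funUnique (Fin 1) (Fin 2)).symm.sum_comp, Fin.sum_univ_two]
  rfl

/-- The first column of a gate matrix is normalized. -/
lemma Gate.sum_conj_logical_mul {m : ℕ} (U : Gate m) :
    ∑ ν, conj (U.logical ν fun _ => 0) * U.logical ν (fun _ => 0) = 1 := by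
  cases U
  · simp [sum_bits_one, Gate.logical, oneQubit]
  · simp [sum_bits_one, Gate.logical, oneQubit]
  · have h : (Real.sqrt 2 : ℂ)⁻¹ * (Real.sqrt 2 : ℂ)⁻¹ = 1 / 2 := by
      rw [← mul_inv, ← Complex.ofReal_mul, Real.mul_self_sqrt (by norm_num)]
      norm_num
    simp only [sum_bits_one, logical_H, map_mul, map_inv₀, map_pow, map_neg, map_one,
      Complex.conj_ofReal]
    simp only [Fin.val_zero, mul_zero, pow_zero, mul_one, h]
    norm_num
  · simp [Gate.logical, Matrix.one_apply]
  · rw [Finset.sum_eq_single_of_mem (fun _ => 0) (Finset.mem_univ _)]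
    · simp [Gate.logical]
    · intro ν _ hν
      have : Gate.CNOT.logical ν (fun _ => 0) = 0 := by
        simp only [Gate.logical, Matrix.of_apply]
        refine if_neg fun h => hν (funext fun i => ?_)
        fin_cases i
        · exact h.1
        · simpa using h.2
      rw [this, mul_zero]

/-- The noiseless gates act on the states supported in a square as the qubit gate, tensored with
an operator on the syndromes. -/
lemma Gate.exists_physical_sssIncl {m : ℕ} (U : Gate m) {r : Fin m → ℝ} (hr : ∀ i, 0 ≤ r i)
    (hrc : ∑ i, r i ≤ c / 2) (g : Syndrome m) :
    ∃ h : Syndrome m, squareProj (fun _ => ∑ i, r i) h = h ∧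
      ∀ μ, U.physical (sssIncl μ (squareProj r g)) = ∑ ν, U.logical ν μ • sssIncl ν h := by
  have h1 : ∀ r : Fin 1 → ℝ, (fun _ => ∑ i, r i) = r := fun r => by
    funext i; rw [Fin.sum_univ_one, Subsingleton.elim i 0]
  have h2 : ∀ r : Fin 1 → ℝ, ∑ i, r i ≤ c / 2 → ∀ i, r i ≤ c / 2 := fun r h i => by
    rwa [Fin.sum_univ_one, ← Subsingleton.elim i 0] at h
  cases U
  · rw [h1]; exact exists_X_sssIncl (h2 r hrc) g
  · rw [h1]; exact exists_Z_sssIncl (h2 r hrc) g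
  · rw [h1]; exact exists_H_sssIncl g
  · rw [h1]; exact exists_I_sssIncl g
  · exact exists_CNOT_sssIncl hr (fun i => Fin.sum_univ_two r) (by rwa [Fin.sum_univ_two] at hrc) g

/-- An operator that acts on the states supported in `square r` as the qubit operator `L`, tensored
with an operator mapping into the functions supported in `square R`. -/
def ActsAs {m : ℕ} (B : Mode m →L[ℂ] Mode m) (L : Matrix (Bits m) (Bits m) ℂ)
    (r R : Fin m → ℝ) : Prop :=
  ∀ g : Syndrome m, ∃ h : Syndrome m, squareProj R h = h ∧
    ∀ μ, B (sssIncl μ (squareProj r g)) = ∑ ν, L ν μ • sssIncl ν h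

lemma ActsAs.comp_displacementCombination {m : ℕ} {s : ℝ} {B A : Mode m →L[ℂ] Mode m}
    {L : Matrix (Bits m) (Bits m) ℂ} {r r' R : Fin m → ℝ} (hB : ActsAs B L r r')
    (hA : IsDisplacementCombination s A) (hs : 0 ≤ s) (hrR : ∀ i, r' i + s ≤ R i)
    (hR : ∀ i, R i ≤ c / 2) : ActsAs (A ∘L B) L r R := by
  intro g
  obtain ⟨h, h1, h2⟩ := hB g
  obtain ⟨k, k1, k2⟩ := hA.exists_sssIncl hs hrR hR h
  refine ⟨k, k1, fun μ => ?_⟩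
  rw [ContinuousLinearMap.comp_apply, h2, map_sum]
  refine Finset.sum_congr rfl fun ν _ => ?_
  rw [map_smul, ← k2, h1]

/-- This is Gate A for a single Kraus operator. -/
lemma ActsAs.sssFilter_comp {m : ℕ} {B : Mode m →L[ℂ] Mode m} {L : Matrix (Bits m) (Bits m) ℂ}
    {r R : Fin m → ℝ} (hB : ActsAs B L r R) :
    sssFilter R ∘L B ∘L sssFilter r = B ∘L sssFilter r := by
  ext1 ψ
  simp only [ContinuousLinearMap.comp_apply, sssFilter_apply r, map_sum]
  refine Finset.sum_congr rfl fun μ _ => ?_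
  obtain ⟨h, h1, h2⟩ := hB (ContinuousLinearMap.adjoint (sssIncl μ) ψ)
  rw [h2, map_sum]
  refine Finset.sum_congr rfl fun ν _ => ?_
  rw [map_smul, sssFilter_sssIncl, h1]

/-! ### The decoded output and the theorem. -/

lemma adjoint_sssIncl_sssFilter {m : ℕ} (r : Fin m → ℝ) (μ : Bits m) (ψ : Mode m) :
    ContinuousLinearMap.adjoint (sssIncl μ) (sssFilter r ψ) =
      squareProj r (ContinuousLinearMap.adjoint (sssIncl μ) ψ) := by
  simp [sssFilter_apply, adjoint_sssIncl_sssIncl]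

/-- The entries of the decoded state of `∑ k, |a k⟩⟨b k|`. -/
lemma hasSum_decoder {m : ℕ} {ι : Type*} {a b : ι → Mode m} {T : Mode m →L[ℂ] Mode m}
    (hs : Summable fun k => ‖a k‖ * ‖b k‖)
    (hT : HasSum (fun k => InnerProductSpace.rankOne ℂ (a k) (b k)) T) (μ ν : Bits m) :
    HasSum (fun k => ⟪ContinuousLinearMap.adjoint (sssIncl ν) (b k),
      ContinuousLinearMap.adjoint (sssIncl μ) (a k)⟫_ℂ) (decoder T μ ν) := by
  have h := hasSum_rankOne_comp hT (ContinuousLinearMap.adjoint (sssIncl μ))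
    (ContinuousLinearMap.adjoint (sssIncl ν))
  rw [ContinuousLinearMap.adjoint_adjoint] at h
  exact hasSum_opTrace (summable_norm_map hs _ _) h

lemma inner_sum_smul_sum_smul {ι E : Type*} [Fintype ι] [NormedAddCommGroup E]
    [InnerProductSpace ℂ E] (u v : ι → ℂ) (x y : ι → E) :
    ⟪∑ i, u i • x i, ∑ j, v j • y j⟫_ℂ = ∑ i, ∑ j, conj (u i) * (v j * ⟪x i, y j⟫_ℂ) := by
  rw [sum_inner]
  simp only [inner_sum, inner_smul_left, inner_smul_right]
  exact Finset.sum_congr rfl fun i _ => Finset.sum_congr rfl fun j _ => mul_left_comm _ _ _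

lemma inner_sum_smul_sssIncl {m : ℕ} (u : Bits m → ℂ) (g g' : Syndrome m) :
    ⟪∑ ν, u ν • sssIncl ν g, ∑ ν, u ν • sssIncl ν g'⟫_ℂ =
      (∑ ν, conj (u ν) * u ν) * ⟪g, g'⟫_ℂ := by
  rw [inner_sum_smul_sum_smul, Finset.sum_mul]
  refine Finset.sum_congr rfl fun ν _ => ?_
  rw [Finset.sum_eq_single_of_mem ν (Finset.mem_univ _), inner_sssIncl, mul_assoc]
  intro κ _ hκ
  rw [inner_sssIncl_of_ne hκ.symm, mul_zero, mul_zero]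

/-- A noisy implementation whose Kraus operators all act as `L` on the logical qubits acts as
`L` on the decoded state. -/
lemma decoder_of_actsAs {m : ℕ} {K : ℕ → Mode m →L[ℂ] Mode m} {L : Matrix (Bits m) (Bits m) ℂ}
    {r R : Fin m → ℝ} (hK : ∀ ψ, HasSum (fun k => ‖K k ψ‖ ^ 2) (‖ψ‖ ^ 2))
    (hL : ∑ ν, conj (L ν fun _ => 0) * L ν (fun _ => 0) = 1)
    (hKL : ∀ k, ActsAs (K k) L r R) {T S : Mode m →L[ℂ] Mode m} (hT : IsTraceClass T)
    (hS : HasSum (fun k => conjBy (K k) (conjBy (sssFilter r) T)) S) :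
    decoder S = L * decoder (conjBy (sssFilter r) T) * L.conjTranspose := by
  obtain ⟨a, b, hs, hab⟩ := hT
  have hs' := summable_norm_map hs (sssFilter r) (sssFilter r)
  have hab' : HasSum _ (conjBy (sssFilter r) T) :=
    hasSum_rankOne_comp hab (sssFilter r) (sssFilter r)
  obtain ⟨hs2, hab2⟩ := hasSum_kraus_rankOne hK hs' hab' hS
  -- `F k` is the syndrome factor of `K k`, chosen pointwise; its linearity is never needed, since
  -- it enters only through inner products.
  choose F hF1 hF2 using hKL
  -- `F k` is the same for all logical states, so testing trace preservation on logical zero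
  -- suffices; this is why only the first column of `L` must be normalized.
  have hFin : ∀ g g', HasSum (fun k => ⟪F k g, F k g'⟫_ℂ) ⟪squareProj r g, squareProj r g'⟫_ℂ := by
    intro g g'
    have h1 := hasSum_inner_of_hasSum_norm_sq hK (sssIncl (fun _ => 0) (squareProj r g))
      (sssIncl (fun _ => 0) (squareProj r g'))
    rw [inner_sssIncl] at h1
    refine h1.congr_fun fun k => ?_
    rw [hF2, hF2, inner_sum_smul_sssIncl (fun ν => L ν fun _ => 0), hL, one_mul]
  have hcomp : ∀ k μ ψ, ContinuousLinearMap.adjoint (sssIncl μ) (K k (sssFilter r ψ)) =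
      ∑ l, L μ l • F k (ContinuousLinearMap.adjoint (sssIncl l) ψ) := by
    intro k μ ψ
    rw [sssFilter_apply, map_sum, map_sum]
    refine Finset.sum_congr rfl fun l _ => ?_
    rw [hF2, map_sum, Finset.sum_eq_single_of_mem μ (Finset.mem_univ _), map_smul,
      adjoint_sssIncl_apply]
    intro κ _ hκ
    rw [map_smul, adjoint_sssIncl_apply_of_ne hκ.symm, smul_zero]
  ext μ ν
  have h1 := hasSum_decoder hs2 hab2 μ ν
  have hfib : ∀ j, HasSum (fun k =>
      ⟪ContinuousLinearMap.adjoint (sssIncl ν) (K k (sssFilter r (b j))),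
        ContinuousLinearMap.adjoint (sssIncl μ) (K k (sssFilter r (a j)))⟫_ℂ)
      (∑ l, ∑ l', conj (L ν l) * (L μ l' *
        ⟪ContinuousLinearMap.adjoint (sssIncl l) (sssFilter r (b j)),
          ContinuousLinearMap.adjoint (sssIncl l') (sssFilter r (a j))⟫_ℂ)) := fun j => by
    simp only [hcomp, inner_sum_smul_sum_smul, adjoint_sssIncl_sssFilter]
    exact hasSum_sum fun l _ => hasSum_sum fun l' _ => ((hFin _ _).mul_left _).mul_left _
  -- Summing over Kraus operators first, for a fixed rank-one term, eliminates the syndrome factors.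
  have h2 := h1.prod_fiberwise hfib
  have h3 := hasSum_sum (s := Finset.univ) fun l _ => hasSum_sum (s := Finset.univ) fun l' _ =>
    ((hasSum_decoder hs' hab' l' l).mul_left (L μ l')).mul_left (conj (L ν l))
  rw [h2.unique h3]
  simp only [Matrix.mul_apply, Matrix.conjTranspose_apply, Finset.sum_mul]
  refine Finset.sum_congr rfl fun l _ => Finset.sum_congr rfl fun l' _ => ?_
  rw [mul_comm]
  rfl

lemma exists_ne_zero_mode (m : ℕ) : ∃ ψ : Mode m, ψ ≠ 0 := by
  have hv : (volume : Measure (Fin m → ℝ)) (Set.univ.pi fun _ => Set.Ico 0 1) = 1 := by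
    rw [volume_pi_pi]; simp
  refine ⟨indicatorConstLp 2 (MeasurableSet.univ_pi fun _ => measurableSet_Ico)
    (by rw [hv]; simp) (1 : ℂ), fun h => ?_⟩
  have h1 := congrArg norm h
  rw [norm_indicatorConstLp (by simp) (by simp), measureReal_def, hv] at h1
  simp at h1

end GKP

end

theorem mainTheorem6 {m : ℕ} (U : GKP.Gate m) (r : Fin m → ℝ) (hr : ∀ i, 0 < r i) (s : ℝ)
    (hrs : (∑ i, r i) + s < Real.sqrt Real.pi / 2)
    (N : (GKP.Mode m →L[ℂ] GKP.Mode m) → (GKP.Mode m →L[ℂ] GKP.Mode m))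
    (hN : GKP.IsNoiseChannel s N) :
    (∀ T : GKP.Mode m →L[ℂ] GKP.Mode m, GKP.IsTraceClass T →
      GKP.sGate U N (GKP.conjBy (GKP.sssFilter r) T) =
        GKP.conjBy (GKP.sssFilter fun _ => (∑ i, r i) + s)
          (GKP.sGate U N (GKP.conjBy (GKP.sssFilter r) T))) ∧
    (∀ T : GKP.Mode m →L[ℂ] GKP.Mode m, GKP.IsTraceClass T →
      GKP.decoder (GKP.sGate U N (GKP.conjBy (GKP.sssFilter r) T)) =
        U.logical * GKP.decoder (GKP.conjBy (GKP.sssFilter r) T) * U.logical.conjTranspose) := by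
  obtain ⟨K, hKs, hK, hKN⟩ := hN
  -- For `s ≤ 0` all Kraus operators vanish, which contradicts trace preservation on a nonzero
  -- state.
  have hs : 0 < s := by
    by_contra hs
    obtain ⟨i⟩ : Nonempty (Fin m) := by cases U <;> exact ⟨0⟩
    obtain ⟨ψ, hψ⟩ := GKP.exists_ne_zero_mode m
    have h := hK ψ
    simp only [(hKs _).eq_zero (not_lt.mp hs) i, zero_apply, norm_zero, ne_eq,
      OfNat.ofNat_ne_zero, not_false_eq_true, zero_pow] at h
    exact hψ (norm_eq_zero.mp (pow_eq_zero_iff two_ne_zero |>.mp (h.unique hasSum_zero)))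
  have hRc : (∑ i, r i) + s ≤ GKP.c / 2 := hrs.le
  have hU : GKP.ActsAs U.physical U.logical r fun _ => ∑ i, r i :=
    U.exists_physical_sssIncl (fun i => (hr i).le) (by linarith)
  have hB : ∀ k, GKP.ActsAs (K k ∘L U.physical) U.logical r fun _ => (∑ i, r i) + s := fun k =>
    hU.comp_displacementCombination (hKs k) hs.le (fun _ => le_rfl) fun _ => hRc
  have hsum : ∀ T, GKP.IsTraceClass T →
      HasSum (fun k => GKP.conjBy (K k ∘L U.physical) (GKP.conjBy (GKP.sssFilter r) T))
        (GKP.sGate U N (GKP.conjBy (GKP.sssFilter r) T)) := fun T hT => by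
    have h := hKN _ (GKP.isTraceClass_conjBy (GKP.isTraceClass_conjBy hT (GKP.sssFilter r))
      U.physical)
    exact h.congr_fun fun k => (GKP.conjBy_conjBy (K k) U.physical _).symm
  refine ⟨fun T hT => ?_, fun T hT => ?_⟩
  · have h := GKP.hasSum_comp_comp (hsum T hT) (GKP.sssFilter fun _ => (∑ i, r i) + s)
      (ContinuousLinearMap.adjoint (GKP.sssFilter fun _ => (∑ i, r i) + s))
    refine (hsum T hT).unique (h.congr_fun fun k => ?_)
    change _ = GKP.conjBy _ (GKP.conjBy _ (GKP.conjBy _ T))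
    -- Both filters are merged into one conjugation, where the outer one is absorbed.
    rw [GKP.conjBy_conjBy, GKP.conjBy_conjBy, (hB k).sssFilter_comp]
  · refine GKP.decoder_of_actsAs (fun ψ => ?_) U.sum_conj_logical_mul hB hT (hsum T hT)
    -- The gate is an isometry, so the operators `K k ∘L U.physical` again satisfy the
    -- trace-preservation identity.
    have h := hK (U.physical ψ)
    rwa [U.norm_physical] at h
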